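/- For a positive integer $k$ and a real number $N\ge 1$, let $r_k(N)$ be the maximum possible size of a subset of $[1,N]\cap\mathbb{Z}=\{1,2,\dots,\lfloor N\rfloor\}$ that does not contain $k$ numbers in arithmetic progression (with nonzero common difference), and let $\log$ denote the base-2 logarithm. Let $k\ge 3$ be an integer and set $n=\lceil\log k\rceil$. There exists a constant $C>0$ (which may depend on $k$, but not on $N$) such that for all real $N\ge 1$ \[\frac{r_k(N)}{N}\ \ge\ C\,\frac{(\log N)^{1/(2n)}}{2^{\,n\,2^{(n-1)/2}\,(\log N)^{1/n}}}.\] Moreover, for every $\epsilon>0$ and all sufficiently large real $N$ (depending on $\epsilon$), \[\frac{r_3(N)}{N}\ \ge\ \left(\frac{\sqrt{360}}{e\,\pi^{3/2}}-\epsilon\right)\frac{(2\log N)^{1/4}}{2^{\,2\sqrt{2\log N}}}.\] -/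

import Mathlib

/-- The set `A` of natural numbers contains `k` numbers in (proper) arithmetic progression
`a, a + d, …, a + (k - 1) d` with common difference `d > 0`. -/
def ContainsAP (k : ℕ) (A : Finset ℕ) : Prop :=
  ∃ a d : ℕ, 0 < d ∧ ∀ i < k, a + i * d ∈ A

/-- `rMax k M` is the maximum possible size of a subset of `{1, 2, …, M}` that does not contain
`k` numbers in arithmetic progression. -/
noncomputable def rMax (k M : ℕ) : ℕ :=
  sSup {m : ℕ | ∃ A : Finset ℕ, A ⊆ Finset.Icc 1 M ∧ ¬ ContainsAP k A ∧ A.card = m}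

open Finset MeasureTheory ProbabilityTheory Filter Topology

/-! The sets come from spherical shells on a torus. Fix a direction `θ` and a shift `α` in the
`d`-dimensional torus, and keep those `n ≤ N` for which `n θ + α` lies in a small cube and has its
sum of squared coordinates in a thin set `T`. A progression `b` of exact degree `p ≤ D` among these
integers lifts to real coordinates `x_i(j)` of degree at most `p`, since the cube is too small for
wrap-around. Hence `∑ x_i²` has degree at most `2p`. If `T` confines such sequences to an interval
of length `τ`, the leading difference `(2p choose p) ∑ (Δ^p x_i)²` is small. But `Δ^p x` lifts `m θ`
with `m = Δ^p b ≠ 0`, and `θ` is chosen so that no such multiple is near the origin. So only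
constant progressions survive (`isFree_filter_torusSet`). A union bound gives `θ` and averaging
gives `α` (`exists_isFree_card_ge`). The central limit theorem for squares of uniform variables,
with a further averaging over translates of `T`, makes the density explicit
(`exists_isFree_of_nearConst`).

The set `T` may be one interval of length `τ`, or a union of such intervals at the points of a
dilated set that is already free for degree `2D`. The second choice is a recursion from degree `2D`
to degree `D` (`HasFreeDensity.step`). It costs a factor `2^(-D d)` and replaces `log N` by about `2
log N / d`. Starting from a singleton at degree `2^(n-1)` and balancing the dimensions
(`optDim_step`), one reaches degree `1` with the stated exponent (`hasFreeDensity_densityProfile`);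
the only requirement is `2^(n-1) < k`.

For `k = 3` a single shell is used with all constants kept. The window around the mean has
half-width `η √d`, and a small `η` brings in the Gaussian density at its centre
(`floor_mul_shellDensity_le`, `sqrt_360_div_mul_exp_le`). -/

/-- The `n`-th forward difference of the sequence `f` at `j`. -/
def fdiff {G : Type*} [AddCommGroup G] (n : ℕ) (f : ℕ → G) (j : ℕ) : G :=
  (fwdDiff 1)^[n] f j

/-! ### Calculus of forward differences -/

section fdiff
variable {G H : Type*} [AddCommGroup G] [AddCommGroup H]

@[simp] lemma fdiff_zero (f : ℕ → G) (j : ℕ) : fdiff 0 f j = f j := rfl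

lemma fdiff_succ (n : ℕ) (f : ℕ → G) (j : ℕ) :
    fdiff (n + 1) f j = fdiff n f (j + 1) - fdiff n f j := by
  simp only [fdiff, Function.iterate_succ_apply', fwdDiff]

lemma fdiff_congr {f g : ℕ → G} {n j : ℕ} (h : ∀ i, j ≤ i → i ≤ j + n → f i = g i) :
    fdiff n f j = fdiff n g j := by
  induction n generalizing j with
  | zero => exact h j le_rfl le_rfl
  | succ n ih =>
    rw [fdiff_succ, fdiff_succ, ih fun i h1 h2 => h i (by lia) (by lia),
      ih fun i h1 h2 => h i (by lia) (by lia)]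

lemma fdiff_map (φ : G →+ H) (f : ℕ → G) (n j : ℕ) :
    fdiff n (fun i => φ (f i)) j = φ (fdiff n f j) := by
  induction n generalizing j with
  | zero => rfl
  | succ n ih => rw [fdiff_succ, fdiff_succ, ih, ih, map_sub]

lemma fdiff_add (f g : ℕ → G) (n j : ℕ) :
    fdiff n (fun i => f i + g i) j = fdiff n f j + fdiff n g j := by
  induction n generalizing j with
  | zero => rfl
  | succ n ih => simp only [fdiff_succ, ih]; abel

lemma fdiff_sum {ι : Type*} (s : Finset ι) (f : ι → ℕ → G) (n j : ℕ) :
    fdiff n (fun i => ∑ l ∈ s, f l i) j = ∑ l ∈ s, fdiff n (f l) j := by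
  induction n generalizing j with
  | zero => rfl
  | succ n ih => simp only [fdiff_succ, ih, sum_sub_distrib]

lemma fdiff_succ_const (c : G) (n j : ℕ) : fdiff (n + 1) (fun _ => c) j = 0 := by
  induction n generalizing j with
  | zero => simp [fdiff_succ]
  | succ n ih => rw [fdiff_succ, ih, ih, sub_zero]

lemma fdiff_eq_zero_of_le {f : ℕ → G} {k p q : ℕ} (hpq : p ≤ q)
    (h : ∀ j, j + p < k → fdiff p f j = 0) : ∀ j, j + q < k → fdiff q f j = 0 := by
  induction q, hpq using Nat.le_induction with
  | base => exact h
  | succ q _ ih =>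
    intro j hj
    rw [fdiff_succ, ih _ (by lia), ih _ (by lia), sub_zero]

lemma fdiff_eq_of_succ_eq_zero {f : ℕ → G} {k p : ℕ}
    (h : ∀ j, j + (p + 1) < k → fdiff (p + 1) f j = 0) {j : ℕ} (hj : j + p < k) :
    fdiff p f j = fdiff p f 0 := by
  induction j with
  | zero => rfl
  | succ j ih =>
    rw [← ih (by lia), ← sub_eq_zero, ← fdiff_succ, h j (by lia)]

/-- The Leibniz rule for forward differences. -/
lemma fdiff_mul (f g : ℕ → ℝ) (n j : ℕ) :
    fdiff n (fun i => f i * g i) j =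
      ∑ p ∈ antidiagonal n, n.choose p.1 • (fdiff p.1 f j * fdiff p.2 g (j + p.1)) := by
  induction n generalizing j with
  | zero => simp
  | succ n ih =>
    rw [Finset.sum_antidiagonal_choose_succ_nsmul (fun a b => fdiff a f j * fdiff b g (j + a)),
      fdiff_succ, ih, ih, ← sum_add_distrib, ← sum_sub_distrib]
    refine sum_congr rfl fun p hp => ?_
    rw [← Nat.choose_symm_of_eq_add (mem_antidiagonal.mp hp).symm, fdiff_succ, fdiff_succ,
      ← smul_sub, ← smul_add]
    congr 1
    rw [show j + 1 + p.1 = j + p.1 + 1 by ring, show j + (p.1 + 1) = j + p.1 + 1 by ring]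
    ring

/-- In the Leibniz sum the two orders add up to `2D + 1`, so one of them exceeds `D`. -/
lemma fdiff_sq_eq_zero {f : ℕ → ℝ} {k D : ℕ} (h : ∀ j, j + (D + 1) < k → fdiff (D + 1) f j = 0)
    {j : ℕ} (hj : j + (2 * D + 1) < k) : fdiff (2 * D + 1) (fun i => f i ^ 2) j = 0 := by
  simp only [sq]
  rw [fdiff_mul]
  refine sum_eq_zero fun p hp => ?_
  have hp := mem_antidiagonal.mp hp
  rcases le_or_gt (D + 1) p.1 with h1 | h1
  · rw [fdiff_eq_zero_of_le h1 h j (by lia), zero_mul, smul_zero]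
  · rw [fdiff_eq_zero_of_le (q := p.2) (by lia) h _ (by lia), mul_zero, smul_zero]

/-- Only the middle Leibniz term `(D, D)` has neither order above `D`. -/
lemma fdiff_sq_eq {f : ℕ → ℝ} {k D : ℕ} (h : ∀ j, j + (D + 1) < k → fdiff (D + 1) f j = 0)
    (hk : 2 * D < k) :
    fdiff (2 * D) (fun i => f i ^ 2) 0 = (2 * D).choose D * fdiff D f 0 ^ 2 := by
  simp only [sq]
  rw [fdiff_mul, sum_eq_single (D, D)]
  · rw [fdiff_eq_of_succ_eq_zero (j := 0 + D) h (by lia), nsmul_eq_mul]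
  · intro p hp hne
    have hp := mem_antidiagonal.mp hp
    rcases lt_trichotomy p.1 D with h1 | h1 | h1
    · rw [fdiff_eq_zero_of_le (q := p.2) (by lia) h _ (by lia), mul_zero, smul_zero]
    · exact absurd (Prod.ext h1 (by lia : p.2 = D)) hne
    · rw [fdiff_eq_zero_of_le (by lia : D + 1 ≤ p.1) h _ (by lia), zero_mul, smul_zero]
  · intro hn
    exact absurd (HasAntidiagonal.mem_antidiagonal.mpr (by simp; ring)) hn

lemma abs_fdiff_lt {f : ℕ → ℝ} {n j : ℕ} {c : ℝ} (h : ∀ i, j ≤ i → i ≤ j + n → |f i| < c) :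
    |fdiff n f j| < 2 ^ n * c := by
  induction n generalizing j with
  | zero => simpa using h j le_rfl le_rfl
  | succ n ih =>
    have h1 := ih (j := j) fun i h1 h2 => h i (by lia) (by lia)
    have h2 := ih (j := j + 1) fun i h1 h2 => h i (by lia) (by lia)
    rw [fdiff_succ, pow_succ]
    rw [abs_lt] at *
    constructor <;> linarith

/-- The first difference is bounded by the length of the interval, and each later one at most
doubles. This is independent of where the interval lies. -/
lemma abs_fdiff_succ_le {f : ℕ → ℝ} {n j : ℕ} {a b : ℝ}
    (h : ∀ i, j ≤ i → i ≤ j + (n + 1) → f i ∈ Set.Icc a b) :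
    |fdiff (n + 1) f j| ≤ 2 ^ n * (b - a) := by
  induction n generalizing j with
  | zero =>
    have h1 := h j le_rfl (by lia)
    have h2 := h (j + 1) (by lia) (by lia)
    rw [fdiff_succ, abs_le]
    simp only [fdiff_zero, Set.mem_Icc] at *
    constructor <;> linarith
  | succ n ih =>
    have h1 := ih (j := j) fun i h1 h2 => h i (by lia) (by lia)
    have h2 := ih (j := j + 1) fun i h1 h2 => h i (by lia) (by lia)
    rw [fdiff_succ, pow_succ]
    rw [abs_le] at *
    constructor <;> linarith

end fdiff

/-! ### Progression-free sets and near-constant progressions -/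

/-- `A` contains no nonconstant `k`-term progression of degree at most `D`. -/
def IsFree (k D : ℕ) (A : Finset ℤ) : Prop :=
  ∀ b : ℕ → ℤ, (∀ j, j + (D + 1) < k → fdiff (D + 1) b j = 0) → (∀ j < k, b j ∈ A) →
    ∀ j < k, b j = b 0

/-- Real `k`-term progressions of degree at most `D` with values in `T` stay in an interval of
length `τ`. -/
def NearConst (k D : ℕ) (T : Set ℝ) (τ : ℝ) : Prop :=
  ∀ q : ℕ → ℝ, (∀ j, j + (D + 1) < k → fdiff (D + 1) q j = 0) → (∀ j < k, q j ∈ T) →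
    ∃ c, ∀ j < k, q j ∈ Set.Icc c (c + τ)

lemma isFree_singleton (k D : ℕ) (a : ℤ) : IsFree k D {a} := by
  intro b _ hb j hj
  rw [mem_singleton.mp (hb j hj), mem_singleton.mp (hb 0 (by lia))]

lemma nearConst_Icc (k D : ℕ) (c τ : ℝ) : NearConst k D (Set.Icc c (c + τ)) τ :=
  fun _ _ h => ⟨c, h⟩

/-- Write `q = c + δ (b + e)` with `b` integral and `0 ≤ e ≤ η`. The differences of order `D + 1` of
`b` are minus those of `e`, hence integers of absolute value below `1`. So `b` has degree at most
`D`, and freeness makes it constant. -/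
lemma IsFree.nearConst {k D : ℕ} {A : Finset ℤ} (hA : IsFree k D A) {c δ η : ℝ} (hδ : 0 < δ)
    (hη : 2 ^ D * η < 1) :
    NearConst k D (⋃ a ∈ A, Set.Icc (c + δ * a) (c + δ * (a + η))) (δ * η) := by
  intro q hq hT
  have hT' : ∀ j, ∃ a : ℤ, j < k → a ∈ A ∧ q j ∈ Set.Icc (c + δ * a) (c + δ * (a + η)) := by
    intro j
    by_cases hj : j < k
    · obtain ⟨a, ha, h⟩ := Set.mem_iUnion₂.mp (hT j hj)
      exact ⟨a, fun _ => ⟨ha, h⟩⟩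
    · exact ⟨0, fun h => absurd h hj⟩
  choose b hb using hT'
  have hconst : ∀ j < k, b j = b 0 := by
    refine hA b (fun j hj => ?_) fun j hj => (hb j hj).1
    set e : ℕ → ℝ := fun i => (q i - c) / δ - b i with he
    have h1 : fdiff (D + 1) (fun i => (b i : ℝ) + e i) j = 0 := by
      rw [fdiff_congr (g := fun i => q i * δ⁻¹ + (- c / δ)) fun i _ _ => by
        simp only [he]; field_simp; ring, fdiff_add, fdiff_succ_const]
      have := fdiff_map (AddMonoidHom.mulRight δ⁻¹) q (D + 1) j
      simp only [AddMonoidHom.coe_mulRight] at this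
      rw [this, hq j hj]; simp
    have h2 : |fdiff (D + 1) e j| ≤ 2 ^ D * (η - 0) := by
      refine abs_fdiff_succ_le fun i _ hi => ?_
      obtain ⟨h3, h4⟩ := (hb i (by lia)).2
      simp only [he, Set.mem_Icc]
      constructor
      · rw [sub_nonneg, le_div_iff₀ hδ]; linarith
      · rw [sub_le_iff_le_add, div_le_iff₀ hδ]; linarith
    rw [fdiff_add] at h1
    have h5 : fdiff (D + 1) (fun i => (b i : ℝ)) j = (fdiff (D + 1) b j : ℤ) :=
      fdiff_map (Int.castAddHom ℝ) b _ _
    rw [h5] at h1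
    have h6 : |((fdiff (D + 1) b j : ℤ) : ℝ)| < 1 := by
      rw [eq_neg_of_add_eq_zero_left h1, abs_neg]; linarith
    exact Int.abs_lt_one_iff.mp (by exact_mod_cast h6)
  refine ⟨c + δ * b 0, fun j hj => ?_⟩
  have := (hb j hj).2
  rw [hconst j hj] at this
  convert this using 2
  ring

lemma IsFree.not_containsAP {k : ℕ} (hk : 3 ≤ k) {A : Finset ℤ} (hA : IsFree k 1 A) {B : Finset ℕ}
    (hB : ∀ b ∈ B, (b : ℤ) ∈ A) : ¬ ContainsAP k B := by
  rintro ⟨a, d, hd, h⟩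
  have := hA (fun i => ((a + i * d : ℕ) : ℤ)) (fun j _ => ?_) (fun j hj => hB _ (h j hj)) 1 (by lia)
  · simp at this; lia
  · simp only [fdiff_succ, fdiff_zero]; push_cast; ring

lemma IsFree.card_le_rMax {k : ℕ} (hk : 3 ≤ k) {A : Finset ℤ} (hA : IsFree k 1 A) {M : ℕ}
    (hM : A ⊆ Icc 1 (M : ℤ)) : A.card ≤ rMax k M := by
  refine le_csSup ⟨M, ?_⟩ ⟨A.image Int.toNat, ?_, ?_, ?_⟩
  · rintro _ ⟨B, hB, -, rfl⟩
    simpa using card_le_card hB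
  · intro b hb
    obtain ⟨a, ha, rfl⟩ := mem_image.mp hb
    have := mem_Icc.mp (hM ha)
    simp; lia
  · refine hA.not_containsAP hk fun b hb => ?_
    obtain ⟨a, ha, rfl⟩ := mem_image.mp hb
    have := mem_Icc.mp (hM ha)
    rwa [Int.toNat_of_nonneg (by lia)]
  · refine card_image_of_injOn fun a ha b hb h => ?_
    have h1 := mem_Icc.mp (hM ha)
    have h2 := mem_Icc.mp (hM hb)
    lia

/-! ### Freeness of sets cut out by the torus -/

lemma UnitAddCircle.exists_coe_eq_abs_eq (t : UnitAddCircle) :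
    ∃ x : ℝ, (x : UnitAddCircle) = t ∧ |x| = ‖t‖ := by
  induction t using QuotientAddGroup.induction_on with
  | H x =>
    refine ⟨x - round x, ?_, UnitAddCircle.norm_eq.symm⟩
    rw [AddCircle.coe_sub, sub_eq_self, AddCircle.coe_eq_zero_iff]
    exact ⟨round x, by simp⟩

/-- The points of the torus with coordinates close to `0` whose sum of squares lies in `T`. -/
def torusSet (d D : ℕ) (T : Set ℝ) : Set (Fin d → UnitAddCircle) :=
  {t | (∀ i, ‖t i‖ < (1 / 2) ^ (D + 1)) ∧ ∑ i, ‖t i‖ ^ 2 ∈ T}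

/-- The points of the cube of side `2 ^ (-D)` whose sum of squares lies in `T`. -/
def cubeSet (d D : ℕ) (T : Set ℝ) : Set (Fin d → ℝ) :=
  {x | (∀ i, |x i| < (1 / 2) ^ (D + 1)) ∧ ∑ i, x i ^ 2 ∈ T}

/-- Central binomial bound: it turns the quotient of `2^(2p-1)` by the leading coefficient `(2p
choose p)` into at most `p`. -/
lemma two_pow_le_mul_choose {p : ℕ} (hp : 0 < p) :
    (2 : ℝ) ^ (2 * p) ≤ 2 * p * (2 * p).choose p := by
  have := Nat.four_pow_le_two_mul_self_mul_centralBinom p hp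
  rw [Nat.centralBinom_eq_two_mul_choose] at this
  rw [pow_mul]
  exact_mod_cast this

open Classical in
theorem isFree_filter_torusSet {k d D M : ℕ} (hk : 2 * D < k) {T : Set ℝ} {τ : ℝ}
    (hT : NearConst k (2 * D) T τ) (θ α : Fin d → UnitAddCircle)
    (hθ : ∀ m : ℤ, 1 ≤ m → m ≤ 2 ^ D * M → D * τ < ∑ i, ‖m • θ i‖ ^ 2) :
    IsFree k D ((Icc 1 (M : ℤ)).filter fun n => (fun i => n • θ i + α i) ∈ torusSet d D T) := by
  intro b hb hmem
  have hex : ∃ e, ∀ j, j + e < k → fdiff e b j = 0 := ⟨D + 1, hb⟩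
  have hspec := Nat.find_spec hex
  have hle : Nat.find hex ≤ D + 1 := Nat.find_min' hex hb
  have hmin := fun m => Nat.find_min hex (m := m)
  generalize Nat.find hex = e at *
  have hIcc : ∀ j < k, 1 ≤ b j ∧ b j ≤ M := fun j hj => mem_Icc.mp (mem_filter.mp (hmem j hj)).1
  -- `e` is the least order at which all differences vanish. Order `0` would make the terms zero,
  -- outside `[1, M]`; order `1` is constancy; otherwise the exact degree is `p + 1`.
  rcases e with _ | _ | p
  · have h1 := hspec 0 (by lia)
    have h2 := hIcc 0 (by lia)
    simp at h1; lia
  · exact fun j hj => fdiff_eq_of_succ_eq_zero (p := 0) hspec hj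
  exfalso
  have hnp := hmin (p + 1) (by lia)
  push Not at hnp
  obtain ⟨j₀, hj₀, hne⟩ := hnp
  rw [fdiff_eq_of_succ_eq_zero hspec hj₀] at hne
  set m := fdiff (p + 1) b 0 with hm
  have hmle : |m| ≤ 2 ^ D * M := by
    have h1 : |fdiff (p + 1) (fun i => (b i : ℝ)) 0| ≤ 2 ^ p * ((M : ℝ) - 0) := by
      refine abs_fdiff_succ_le fun i _ hi => ?_
      have := hIcc i (by lia)
      exact ⟨by exact_mod_cast (by lia : 0 ≤ b i), by exact_mod_cast this.2⟩
    have h2 : fdiff (p + 1) (fun i => (b i : ℝ)) 0 = (m : ℤ) :=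
      fdiff_map (Int.castAddHom ℝ) b _ _
    rw [h2, sub_zero] at h1
    have h3 : |m| ≤ 2 ^ p * (M : ℤ) := by exact_mod_cast h1
    refine h3.trans ?_
    gcongr
    · norm_num
    · lia
  have hx : ∀ (i : Fin d) (j : ℕ), ∃ x : ℝ, (x : UnitAddCircle) = b j • θ i + α i ∧
      |x| = ‖b j • θ i + α i‖ := fun i j => UnitAddCircle.exists_coe_eq_abs_eq _
  choose x hx1 hx2 using hx
  have hcoe : ∀ i n j, ((fdiff n (x i) j : ℝ) : UnitAddCircle) =
      fdiff n (fun j => b j • θ i + α i) j := by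
    intro i n j
    rw [← fdiff_congr fun l _ _ => hx1 i l]
    exact (fdiff_map (QuotientAddGroup.mk' (AddSubgroup.zmultiples (1 : ℝ))) (x i) n j).symm
  have hcoe' : ∀ i n j, ((fdiff (n + 1) (x i) j : ℝ) : UnitAddCircle) = fdiff (n + 1) b j • θ i := by
    intro i n j
    rw [hcoe, fdiff_add, fdiff_succ_const, add_zero]
    exact fdiff_map ((zmultiplesHom _) (θ i)) b (n + 1) j
  -- No wrap-around: the difference is an integer, as its class on the circle is zero, and the size
  -- of the cube forces its absolute value below `1`.
  have hx0 : ∀ i j, j + (p + 1 + 1) < k → fdiff (p + 1 + 1) (x i) j = 0 := by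
    intro i j hj
    have h1 := hcoe' i (p + 1) j
    rw [hspec j hj, zero_smul, AddCircle.coe_eq_zero_iff] at h1
    obtain ⟨n, hn⟩ := h1
    have h2 : |fdiff (p + 1 + 1) (x i) j| < 2 ^ (p + 1 + 1) * (1 / 2) ^ (D + 1) := by
      refine abs_fdiff_lt fun l _ hl => ?_
      rw [hx2]
      exact (mem_filter.mp (hmem l (by lia))).2.1 i
    have h3 : (2 : ℝ) ^ (p + 1 + 1) * (1 / 2) ^ (D + 1) ≤ 1 := by
      calc (2 : ℝ) ^ (p + 1 + 1) * (1 / 2) ^ (D + 1) ≤ 2 ^ (D + 1) * (1 / 2) ^ (D + 1) := by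
            gcongr; norm_num
        _ = 1 := by rw [← mul_pow]; norm_num
    have h4 : |(n : ℝ)| < 1 := by
      have : (n : ℝ) = fdiff (p + 1 + 1) (x i) j := by simpa using hn
      rw [this]; linarith
    have hn0 : n = 0 := Int.abs_lt_one_iff.mp (by exact_mod_cast h4)
    rw [← hn, hn0, zero_smul]
  obtain ⟨c, hc⟩ := hT (fun j => ∑ i, x i j ^ 2) (fun j hj => by
      rw [fdiff_sum]
      refine sum_eq_zero fun i _ => fdiff_sq_eq_zero (k := k) ?_ hj
      exact fdiff_eq_zero_of_le (by lia) (hx0 i)) fun j hj => by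
    have := (mem_filter.mp (hmem j hj)).2.2
    simp only [← hx2, sq_abs] at this
    exact this
  have hup : |fdiff (2 * (p + 1)) (fun j => ∑ i, x i j ^ 2) 0| ≤ 2 ^ (2 * p + 1) * (c + τ - c) :=
    abs_fdiff_succ_le (n := 2 * p + 1) fun i _ hi => hc i (by lia)
  rw [fdiff_sum, sum_congr rfl fun i _ => fdiff_sq_eq (hx0 i) (by lia), ← mul_sum] at hup
  set Q := ∑ i, fdiff (p + 1) (x i) 0 ^ 2 with hQ
  have hτ : 0 ≤ τ := by
    have := hc 0 (by lia)
    linarith [this.1, this.2]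
  have hQle : Q ≤ D * τ := by
    have h1 := le_of_abs_le hup
    have h2 := two_pow_le_mul_choose (p := p + 1) (by lia)
    have h3 : (0 : ℝ) < (2 * (p + 1)).choose (p + 1) := by
      exact_mod_cast Nat.choose_pos (by lia)
    have h4 : ((p + 1 : ℕ) : ℝ) ≤ D := by exact_mod_cast (by lia : p + 1 ≤ D)
    have h5 : (2 : ℝ) ^ (2 * (p + 1)) = 2 * 2 ^ (2 * p + 1) := by ring
    have h6 : ((2 * (p + 1)).choose (p + 1) : ℝ) * Q ≤
        (2 * (p + 1)).choose (p + 1) * (D * τ) := by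
      calc _ ≤ (2 : ℝ) ^ (2 * p + 1) * τ := by linarith
        _ ≤ (p + 1 : ℕ) * (2 * (p + 1)).choose (p + 1) * τ := by gcongr; linarith
        _ ≤ D * (2 * (p + 1)).choose (p + 1) * τ := by gcongr
        _ = _ := by ring
    exact le_of_mul_le_mul_left h6 h3
  have hsum : ∑ i, ‖m • θ i‖ ^ 2 ≤ Q := by
    refine sum_le_sum fun i _ => ?_
    rw [hm, ← hcoe', ← sq_abs (fdiff (p + 1) (x i) 0)]
    gcongr
    rw [UnitAddCircle.norm_eq]
    simpa using round_le (fdiff (p + 1) (x i) 0) 0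
  have h1 : ∑ i, ‖|m| • θ i‖ ^ 2 = ∑ i, ‖m • θ i‖ ^ 2 := by
    rcases abs_choice m with h | h <;> simp [h]
  have h2 := hθ |m| (Int.one_le_abs hne) hmle
  linarith

/-! ### Haar measure: choosing the direction and the shift -/

lemma measurableSet_torusSet {d D : ℕ} {T : Set ℝ} (hT : MeasurableSet T) :
    MeasurableSet (torusSet d D T) := by
  have h : MeasurableSet {t : Fin d → UnitAddCircle | ∀ i, ‖t i‖ < (1 / 2) ^ (D + 1)} := by
    rw [Set.ofPred_forall]
    exact MeasurableSet.iInter fun i => measurableSet_lt (by fun_prop) (by fun_prop)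
  exact h.inter <| hT.preimage (f := fun t : Fin d → UnitAddCircle => ∑ i, ‖t i‖ ^ 2) (by fun_prop)

lemma volume_eq_volume_lift {d : ℕ} {E : Set (Fin d → UnitAddCircle)} (hE : MeasurableSet E) :
    volume E = volume ({x : Fin d → ℝ | (fun i => (x i : UnitAddCircle)) ∈ E} ∩
      Set.univ.pi fun _ => Set.Ioc (-1 / 2) (1 / 2)) := by
  have h := measurePreserving_pi (fun _ : Fin d => volume.restrict (Set.Ioc (-1 / 2 : ℝ) (-1 / 2 + 1)))
    (fun _ => (volume : Measure UnitAddCircle)) fun _ => AddCircle.measurePreserving_mk 1 (-1 / 2)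
  rw [volume_pi, ← h.measure_preimage hE.nullMeasurableSet, ← Measure.restrict_pi_pi,
    Measure.restrict_apply (h.measurable hE), ← volume_pi]
  norm_num
  rfl

lemma norm_coe_eq_abs {x : ℝ} (hx : x ∈ Set.Ioc (-1 / 2 : ℝ) (1 / 2)) :
    ‖(x : UnitAddCircle)‖ = |x| := by
  rw [AddCircle.norm_coe_eq_abs_iff 1 one_ne_zero, abs_one, abs_le]
  constructor <;> linarith [hx.1, hx.2]

lemma volume_torusSet {d D : ℕ} {T : Set ℝ} (hT : MeasurableSet T) :
    volume (torusSet d D T) = volume (cubeSet d D T) := by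
  rw [volume_eq_volume_lift (measurableSet_torusSet hT)]
  congr 1
  have hD : ((1 : ℝ) / 2) ^ (D + 1) ≤ 1 / 2 := by
    rw [pow_succ]
    have : ((1 : ℝ) / 2) ^ D ≤ 1 := pow_le_one₀ (by norm_num) (by norm_num)
    linarith
  have key : ∀ x : Fin d → ℝ, (∀ i, x i ∈ Set.Ioc (-1 / 2 : ℝ) (1 / 2)) →
      ((fun i => (x i : UnitAddCircle)) ∈ torusSet d D T ↔ x ∈ cubeSet d D T) := by
    intro x hx
    simp only [torusSet, cubeSet, Set.mem_ofPred_eq, norm_coe_eq_abs (hx _), sq_abs]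
  ext x
  constructor
  · rintro ⟨h1, h2⟩
    exact (key x fun i => h2 i trivial).mp h1
  · intro h
    have hx : ∀ i, x i ∈ Set.Ioc (-1 / 2 : ℝ) (1 / 2) := fun i => by
      have := abs_lt.mp (h.1 i)
      constructor <;> linarith
    exact ⟨(key x hx).mpr h, fun i _ => hx i⟩

lemma volume_torus_ball_le (d : ℕ) (s : ℝ) :
    volume {t : Fin d → UnitAddCircle | ∑ i, ‖t i‖ ^ 2 ≤ s} ≤
      volume {x : Fin d → ℝ | ∑ i, x i ^ 2 ≤ s} := by
  rw [volume_eq_volume_lift (measurableSet_le (by fun_prop) (by fun_prop))]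
  refine measure_mono fun x hx => ?_
  have h1 : ∑ i, ‖(x i : UnitAddCircle)‖ ^ 2 ≤ s := hx.1
  simp only [norm_coe_eq_abs (hx.2 _ trivial), sq_abs] at h1
  exact h1

instance : IsProbabilityMeasure (volume : Measure UnitAddCircle) := ⟨by simp⟩

instance (d : ℕ) : IsProbabilityMeasure (volume : Measure (Fin d → UnitAddCircle)) :=
  inferInstanceAs (IsProbabilityMeasure (Measure.pi fun _ => volume))

/-- Union bound over `m`: multiplication by a nonzero integer preserves Haar measure, so each bad
set of `θ` has the measure of one small ball. -/
lemma exists_forall_lt_sum_norm_zsmul {d : ℕ} {K : ℕ} {s : ℝ}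
    (h : K * volume {x : Fin d → ℝ | ∑ i, x i ^ 2 ≤ s} < 1) :
    ∃ θ : Fin d → UnitAddCircle, ∀ m : ℤ, 1 ≤ m → m ≤ K → s < ∑ i, ‖m • θ i‖ ^ 2 := by
  set E := {t : Fin d → UnitAddCircle | ∑ i, ‖t i‖ ^ 2 ≤ s} with hE
  have hEm : MeasurableSet E := measurableSet_le (by fun_prop) (by fun_prop)
  by_contra! hcon
  have hcover : (Set.univ : Set (Fin d → UnitAddCircle)) ⊆
      ⋃ m ∈ Icc (1 : ℤ) K, (fun θ : Fin d → UnitAddCircle => fun i => m • θ i) ⁻¹' E := by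
    intro θ _
    obtain ⟨m, h1, h2, h3⟩ := hcon θ
    exact Set.mem_iUnion₂.mpr ⟨m, mem_Icc.mpr ⟨h1, h2⟩, h3⟩
  have h1 : (1 : ENNReal) ≤ ∑ m ∈ Icc (1 : ℤ) K, volume E := by
    calc (1 : ENNReal) = volume (Set.univ : Set (Fin d → UnitAddCircle)) := by simp
      _ ≤ _ := measure_mono hcover
      _ ≤ _ := measure_biUnion_finset_le _ _
      _ = _ := by
        refine sum_congr rfl fun m hm => ?_
        have hm0 : m ≠ 0 := by have := mem_Icc.mp hm; lia
        exact (volume_preserving_pi fun _ : Fin d =>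
          MeasureTheory.Measure.measurePreserving_zsmul (volume : Measure UnitAddCircle) hm0).measure_preimage
            hEm.nullMeasurableSet
  simp only [sum_const, Int.card_Icc, nsmul_eq_mul] at h1
  simp only [add_sub_cancel_right, Int.toNat_natCast] at h1
  refine absurd (h1.trans ?_) (not_le.mpr h)
  gcongr
  exact volume_torus_ball_le d s

-- Averaging over `α`: by translation invariance the mean count is exactly `M * volume E`.
open Classical in
lemma exists_card_filter_ge {d M : ℕ} {E : Set (Fin d → UnitAddCircle)} (hE : MeasurableSet E)
    (θ : Fin d → UnitAddCircle) : ∃ α : Fin d → UnitAddCircle,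
      M * volume E ≤ ((Icc 1 (M : ℤ)).filter fun n => (fun i => n • θ i + α i) ∈ E).card := by
  set f : (Fin d → UnitAddCircle) → ENNReal := fun α =>
    ∑ n ∈ Icc 1 (M : ℤ), E.indicator 1 ((fun i => n • θ i) + α) with hf
  have hmeas : ∀ n : ℤ, Measurable fun α : Fin d → UnitAddCircle =>
      E.indicator (1 : (Fin d → UnitAddCircle) → ENNReal) ((fun i => n • θ i) + α) := fun n =>
    (measurable_one.indicator hE).comp (measurable_const_add _)
  have hint : ∫⁻ α, f α = M * volume E := by
    rw [lintegral_finsetSum _ fun n _ => hmeas n]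
    simp_rw [lintegral_add_left_eq_self (μ := volume) (E.indicator 1), lintegral_indicator_one hE]
    simp
  obtain ⟨α, hα⟩ := exists_lintegral_le (μ := (volume : Measure (Fin d → UnitAddCircle)))
    (f := f) (by rw [hint]; exact ENNReal.mul_ne_top (by simp) (measure_ne_top _ _))
  refine ⟨α, ?_⟩
  rw [← hint]
  refine hα.trans (le_of_eq ?_)
  simp only [hf, Set.indicator_apply, Pi.one_apply, sum_boole]
  rfl

theorem exists_isFree_card_ge {k d D M : ℕ} (hk : 2 * D < k) {T : Set ℝ} {τ : ℝ}
    (hTm : MeasurableSet T) (hT : NearConst k (2 * D) T τ)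
    (hvol : (2 ^ D * M : ℕ) * volume {x : Fin d → ℝ | ∑ i, x i ^ 2 ≤ D * τ} < 1) :
    ∃ A ⊆ Icc 1 (M : ℤ), IsFree k D A ∧ M * volume (cubeSet d D T) ≤ A.card := by
  classical
  obtain ⟨θ, hθ⟩ := exists_forall_lt_sum_norm_zsmul hvol
  obtain ⟨α, hα⟩ := exists_card_filter_ge (M := M) (measurableSet_torusSet (d := d) (D := D) hTm) θ
  refine ⟨_, filter_subset _ _, isFree_filter_torusSet hk hT θ α fun m h1 h2 => hθ m h1 ?_, ?_⟩
  · exact_mod_cast h2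
  · rwa [volume_torusSet hTm] at hα

/-! ### The law of the sum of squares -/

/-- The uniform probability measure on `(-1, 1)`. -/
noncomputable def unifMeasure : Measure ℝ :=
  (2⁻¹ : ENNReal) • volume.restrict (Set.Ioo (-1) 1)

instance : IsProbabilityMeasure unifMeasure := ⟨by
  simp only [unifMeasure, Measure.smul_apply, Measure.restrict_apply_univ, Real.volume_Ioo,
    smul_eq_mul]
  norm_num
  exact ENNReal.inv_mul_cancel (by simp) (by simp)⟩

/-- The law of the sum of the squares of `d` independent uniform random variables on `(-1, 1)`. -/
noncomputable def sqSumLaw (d : ℕ) : Measure ℝ :=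
  (Measure.infinitePi fun _ : ℕ => unifMeasure).map fun ω => ∑ i ∈ range d, ω i ^ 2

lemma measurable_sum_sq (d : ℕ) : Measurable fun ω : ℕ → ℝ => ∑ i ∈ range d, ω i ^ 2 := by
  fun_prop

instance (d : ℕ) : IsProbabilityMeasure (sqSumLaw d) :=
  Measure.isProbabilityMeasure_map (measurable_sum_sq d).aemeasurable

lemma pi_unifMeasure_apply {d : ℕ} {E : Set (Fin d → ℝ)} (hE : MeasurableSet E) :
    Measure.pi (fun _ : Fin d => unifMeasure) E =
      2⁻¹ ^ d * volume (E ∩ Set.univ.pi fun _ => Set.Ioo (-1) 1) := by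
  have h : Measure.pi (fun _ : Fin d => unifMeasure) =
      (2⁻¹ : ENNReal) ^ d • (volume : Measure (Fin d → ℝ)).restrict
        (Set.univ.pi fun _ => Set.Ioo (-1) 1) := by
    refine Measure.pi_eq fun s hs => ?_
    rw [Measure.smul_apply, volume_pi, Measure.restrict_pi_pi, Measure.pi_pi]
    simp [unifMeasure, prod_mul_distrib]
  rw [h, Measure.smul_apply, Measure.restrict_apply hE, smul_eq_mul]

lemma sqSumLaw_apply {d : ℕ} {T : Set ℝ} (hT : MeasurableSet T) :
    sqSumLaw d T = 2⁻¹ ^ d * volume {u : Fin d → ℝ | (∀ i, |u i| < 1) ∧ ∑ i, u i ^ 2 ∈ T} := by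
  have h := (iIndepFun_iff_map_fun_eq_pi_map (f := fun (i : Fin d) (ω : ℕ → ℝ) => ω i)
    (fun i => (measurable_pi_apply (i : ℕ)).aemeasurable)).mp
      ((iIndepFun_infinitePi (P := fun _ : ℕ => unifMeasure) (X := fun _ => id)
        fun _ => measurable_id).precomp Fin.val_injective)
  have h2 : ∀ i : ℕ, (Measure.infinitePi fun _ : ℕ => unifMeasure).map (fun ω => ω i) =
      unifMeasure := fun i => (measurePreserving_eval_infinitePi _ i).map_eq
  simp only [h2] at h
  have hE : MeasurableSet {u : Fin d → ℝ | ∑ i, u i ^ 2 ∈ T} :=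
    hT.preimage (f := fun u : Fin d → ℝ => ∑ i, u i ^ 2) (by fun_prop)
  have h3 := pi_unifMeasure_apply hE
  rw [← h, Measure.map_apply (by fun_prop) hE] at h3
  rw [sqSumLaw, Measure.map_apply (measurable_sum_sq d) hT]
  convert h3 using 2
  · ext ω
    change (∑ i ∈ range d, ω i ^ 2) ∈ T ↔ (∑ i : Fin d, ω i ^ 2) ∈ T
    rw [Fin.sum_univ_eq_sum_range fun i => ω i ^ 2]
  · congr 1
    ext u
    change ((∀ i, |u i| < 1) ∧ _ ) ↔ (_ ∧ ∀ i, i ∈ Set.univ → u i ∈ Set.Ioo (-1 : ℝ) 1)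
    simp only [abs_lt, Set.mem_univ, true_implies, Set.mem_Ioo]
    exact and_comm

lemma volume_cubeSet {d D : ℕ} {T : Set ℝ} (hT : MeasurableSet T) :
    volume (cubeSet d D T) = 2⁻¹ ^ (D * d) * sqSumLaw d {s | (1 / 4) ^ (D + 1) * s ∈ T} := by
  have hr : ((1 : ℝ) / 2) ^ (D + 1) ≠ 0 := by positivity
  have h := Measure.addHaar_preimage_smul (volume : Measure (Fin d → ℝ)) hr (cubeSet d D T)
  have hpre : (fun x => ((1 : ℝ) / 2) ^ (D + 1) • x) ⁻¹' cubeSet d D T =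
      {u : Fin d → ℝ | (∀ i, |u i| < 1) ∧ ∑ i, u i ^ 2 ∈ {s | (1 / 4) ^ (D + 1) * s ∈ T}} := by
    ext u
    change ((∀ i, |((1 : ℝ) / 2) ^ (D + 1) * u i| < (1 / 2) ^ (D + 1)) ∧
      ∑ i, (((1 : ℝ) / 2) ^ (D + 1) * u i) ^ 2 ∈ T) ↔
      ((∀ i, |u i| < 1) ∧ (1 / 4) ^ (D + 1) * ∑ i, u i ^ 2 ∈ T)
    have hpos : (0 : ℝ) < (1 / 2) ^ (D + 1) := by positivity
    simp only [abs_mul, abs_of_pos hpos, mul_pow, ← mul_sum, mul_lt_iff_lt_one_right hpos]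
    rw [← pow_mul, mul_comm (D + 1) 2, pow_mul]
    norm_num
  have h4 : MeasurableSet {s : ℝ | (1 / 4) ^ (D + 1) * s ∈ T} :=
    hT.preimage (f := fun s : ℝ => (1 / 4) ^ (D + 1) * s) (by fun_prop)
  rw [sqSumLaw_apply h4, ← hpre, h, ← mul_assoc, ← mul_assoc]
  have h5 : (2⁻¹ : ENNReal) ^ (D * d) * 2⁻¹ ^ d *
      ENNReal.ofReal |(((1 : ℝ) / 2) ^ (D + 1)) ^ Module.finrank ℝ (Fin d → ℝ)|⁻¹ = 1 := by
    rw [Module.finrank_fin_fun, ← pow_mul, ← pow_add, abs_of_pos (by positivity),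
      show D * d + d = (D + 1) * d by ring, ← inv_pow, ENNReal.ofReal_pow (by norm_num), ← mul_pow]
    norm_num
    rw [ENNReal.inv_mul_cancel (by simp) (by simp), one_pow]
  rw [abs_inv, h5, one_mul]

/-- Fubini: average the mass of the translate `T + c` over `c ∈ [a - w, b]`. This range is long
enough for every `s ∈ [a, b]` to see the whole of `T`. -/
lemma exists_mul_le_measure_shift (ν : Measure ℝ) [IsProbabilityMeasure ν] {T : Set ℝ}
    (hT : MeasurableSet T) {a b w : ℝ} (hw : T ⊆ Set.Icc 0 w) (hab : a < b) (hw0 : 0 ≤ w) :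
    ∃ c : ℝ, volume T * ν (Set.Icc a b) ≤ ENNReal.ofReal (b - a + w) * ν {s | s - c ∈ T} := by
  set J : Set ℝ := Set.Icc (a - w) b with hJ
  have hvJ : volume J = ENNReal.ofReal (b - a + w) := by
    rw [hJ, Real.volume_Icc]; congr 1; ring
  have hpos : 0 < b - a + w := by linarith
  have hmeas : Measurable fun p : ℝ × ℝ => T.indicator (1 : ℝ → ENNReal) (p.2 - p.1) :=
    (measurable_one.indicator hT).comp (measurable_snd.sub measurable_fst)
  have hf : ∀ c : ℝ, ν {s | s - c ∈ T} = ∫⁻ s, T.indicator (1 : ℝ → ENNReal) (s - c) ∂ν := by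
    intro c
    exact (lintegral_indicator_one (hT.preimage (f := fun s => s - c) (by fun_prop))).symm
  have hle : volume T * ν (Set.Icc a b) ≤ ∫⁻ c in J, ν {s | s - c ∈ T} := by
    simp_rw [hf]
    rw [lintegral_lintegral_swap (f := fun c s => T.indicator (1 : ℝ → ENNReal) (s - c))
      hmeas.aemeasurable, ← setLIntegral_const]
    refine (setLIntegral_mono' measurableSet_Icc fun s hs => ?_).trans
      (setLIntegral_le_lintegral _ _)
    have h1 : ∫⁻ c in J, T.indicator (1 : ℝ → ENNReal) (s - c) =
        ∫⁻ c, T.indicator (1 : ℝ → ENNReal) (s - c) := by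
      rw [← lintegral_indicator measurableSet_Icc]
      refine lintegral_congr fun c => ?_
      rw [Set.indicator_apply]
      split_ifs with hc
      · rfl
      · refine (Set.indicator_of_notMem (fun hm => hc ?_) _).symm
        have := hw hm
        exact ⟨by linarith [this.2, hs.1], by linarith [this.1, hs.2]⟩
    rw [h1, lintegral_sub_left_eq_self (μ := volume) (T.indicator 1), lintegral_indicator_one hT]
  have hfin : ∫⁻ c in J, ν {s | s - c ∈ T} ≠ ⊤ := by
    refine ne_top_of_le_ne_top ?_ (setLIntegral_mono' (g := fun _ => 1) measurableSet_Icc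
      fun c _ => prob_le_one)
    simp [hvJ]
  obtain ⟨c, -, hc⟩ := exists_setLAverage_le (μ := volume) (s := J)
    (by rw [hvJ]; simpa using hpos) measurableSet_Icc.nullMeasurableSet hfin
  refine ⟨c, hle.trans ?_⟩
  rw [setLAverage_eq, hvJ] at hc
  rwa [ENNReal.div_le_iff' (by simpa using hpos) (by simp)] at hc

lemma integral_unifMeasure (f : ℝ → ℝ) :
    ∫ u, f u ∂unifMeasure = 2⁻¹ * ∫ u in (-1)..1, f u := by
  rw [unifMeasure, integral_smul_measure, intervalIntegral.integral_of_le (by norm_num),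
    integral_Ioc_eq_integral_Ioo]
  simp

lemma memLp_sq_unifMeasure : MemLp (fun u : ℝ => u ^ 2) 2 unifMeasure := by
  refine MemLp.of_bound (by fun_prop) 1 ?_
  refine Measure.ae_smul_measure ?_ _
  filter_upwards [ae_restrict_mem measurableSet_Ioo] with u hu
  rw [Real.norm_of_nonneg (sq_nonneg u), sq_le_one_iff_abs_le_one, abs_le]
  exact ⟨hu.1.le, hu.2.le⟩

lemma integral_sq_unifMeasure : ∫ u, u ^ 2 ∂unifMeasure = 1 / 3 := by
  rw [integral_unifMeasure, integral_pow]; norm_num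

lemma variance_sq_unifMeasure : Var[fun u => u ^ 2; unifMeasure] = 4 / 45 := by
  rw [variance_eq_sub memLp_sq_unifMeasure, integral_sq_unifMeasure]
  simp only [Pi.pow_apply, ← pow_mul]
  rw [integral_unifMeasure, integral_pow]; norm_num

/-- Central limit theorem: the square of a uniform variable on `(-1, 1)` has mean `1/3` and variance
`4/45`. -/
theorem tendsto_sqSumLaw_Icc {η : ℝ} :
    Tendsto (fun d : ℕ => (sqSumLaw d).real (Set.Icc (d / 3 - η * √d) (d / 3 + η * √d))) atTop
      (𝓝 ((gaussianReal 0 (4 / 45)).real (Set.Icc (-η) η))) := by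
  set P := Measure.infinitePi fun _ : ℕ => unifMeasure with hP
  have hmp : ∀ i : ℕ, MeasurePreserving (fun ω : ℕ → ℝ => ω i) P unifMeasure :=
    fun i => measurePreserving_eval_infinitePi _ i
  have hlaw : ∀ i, P.map (fun ω : ℕ → ℝ => ω i ^ 2) = unifMeasure.map fun u => u ^ 2 := fun i => by
    rw [← (hmp i).map_eq, Measure.map_map (by fun_prop) (by fun_prop)]
    rfl
  have hid : ∀ i, IdentDistrib (fun ω : ℕ → ℝ => ω i ^ 2) (fun u : ℝ => u ^ 2) P unifMeasure :=
    fun i => ⟨((measurable_pi_apply i).pow_const 2).aemeasurable, by fun_prop, hlaw i⟩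
  have hvar : (Var[fun ω : ℕ → ℝ => ω 0 ^ 2; P]).toNNReal = 4 / 45 := by
    rw [(hid 0).variance_eq, variance_sq_unifMeasure]
    ext; push_cast; rw [Real.coe_toNNReal _ (by norm_num)]
  have hclt := tendstoInDistribution_inv_sqrt_mul_sum_sub (Y := id)
    (P' := gaussianReal 0 (Var[fun ω : ℕ → ℝ => ω 0 ^ 2; P]).toNNReal)
    (X := fun i (ω : ℕ → ℝ) => ω i ^ 2) (P := P) ⟨by fun_prop, by simp⟩
    ((hid 0).symm.memLp_iff.mp memLp_sq_unifMeasure)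
    (iIndepFun_infinitePi (P := fun _ : ℕ => unifMeasure) (X := fun _ u => u ^ 2) fun _ => by
      fun_prop) fun i => (hid i).trans (hid 0).symm
  have h := ProbabilityMeasure.tendsto_measure_of_null_frontier_of_tendsto hclt.tendsto
    (E := Set.Icc (-η) η) ?_
  · rw [← NNReal.tendsto_coe] at h
    have hint : ∫ ω : ℕ → ℝ, ω 0 ^ 2 ∂P = 1 / 3 := by
      rw [(hid 0).integral_eq, integral_sq_unifMeasure]
    refine (h.congr' ?_).trans_eq ?_
    · filter_upwards [eventually_gt_atTop 0] with d hd
      have hd' : 0 < √(d : ℝ) := Real.sqrt_pos.mpr (by exact_mod_cast hd)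
      change (P.map (fun ω : ℕ → ℝ => (√(d : ℝ))⁻¹ *
        (∑ k ∈ range d, ω k ^ 2 - d * ∫ ω : ℕ → ℝ, ω 0 ^ 2 ∂P)) (Set.Icc (-η) η)).toReal = _
      rw [sqSumLaw, measureReal_def, Measure.map_apply (measurable_sum_sq d) measurableSet_Icc,
        Measure.map_apply (by fun_prop) measurableSet_Icc, hint]
      congr 2
      ext ω
      simp only [Set.mem_preimage, Set.mem_Icc, inv_mul_eq_div, le_div_iff₀ hd', div_le_iff₀ hd']
      constructor <;> rintro ⟨h1, h2⟩ <;> constructor <;> linarith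
    · change 𝓝 (((gaussianReal 0 Var[fun ω : ℕ → ℝ => ω 0 ^ 2; P].toNNReal).map id
        (Set.Icc (-η) η)).toReal) = _
      rw [Measure.map_id, hvar]
      rfl
  · have h0 : (gaussianReal 0 Var[fun ω : ℕ → ℝ => ω 0 ^ 2; P].toNNReal).map id
        (frontier (Set.Icc (-η) η)) = 0 := by
      rw [Measure.map_id, hvar]
      have := nullSingletonClass_gaussianReal (μ := 0) (v := 4 / 45) (by norm_num)
      refine (((Set.finite_singleton η).insert (-η)).subset ?_).measure_zero _
      rw [isClosed_Icc.frontier_eq]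
      rcases le_or_gt (-η) η with h | h
      · rw [interior_Icc, Set.Icc_sdiff_Ioo_same h]
      · simp [Set.Icc_eq_empty (not_le.mpr h)]
    exact (ProbabilityMeasure.null_iff_toMeasure_null _ _).mpr h0

lemma le_gaussianReal_Icc {v : NNReal} (hv : v ≠ 0) (η : ℝ) :
    (√(2 * Real.pi * v))⁻¹ * Real.exp (-η ^ 2 / (2 * v)) * (2 * η) ≤
      (gaussianReal 0 v).real (Set.Icc (-η) η) := by
  have h : ENNReal.ofReal ((√(2 * Real.pi * v))⁻¹ * Real.exp (-η ^ 2 / (2 * v)) * (2 * η)) ≤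
      gaussianReal 0 v (Set.Icc (-η) η) := by
    rw [gaussianReal_apply 0 hv, ENNReal.ofReal_mul (by positivity),
      show 2 * η = η - (-η) by ring, ← Real.volume_Icc, ← setLIntegral_const]
    refine setLIntegral_mono' measurableSet_Icc fun x hx => ENNReal.ofReal_le_ofReal ?_
    rw [gaussianPDFReal]
    have : (x - 0) ^ 2 ≤ η ^ 2 := by rw [sub_zero]; exact sq_le_sq' hx.1 hx.2
    gcongr
  exact (ENNReal.ofReal_le_iff_le_toReal (measure_ne_top _ _)).mp h

/-! ### Volume of Euclidean balls -/

/-- Restrict the Gamma integral to `x > s`, where `x^s ≥ s^s`. -/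
lemma rpow_div_exp_le_Gamma {s : ℝ} (hs : 0 < s) : (s / Real.exp 1) ^ s ≤ Real.Gamma (s + 1) := by
  have hint := Real.GammaIntegral_convergent (s := s + 1) (by linarith)
  rw [add_sub_cancel_right] at hint
  rw [Real.Gamma_eq_integral (by linarith), add_sub_cancel_right]
  calc (s / Real.exp 1) ^ s = ∫ x in Set.Ioi s, Real.exp (-x) * s ^ s := by
        rw [integral_mul_const, integral_exp_neg_Ioi, Real.div_rpow hs.le (Real.exp_pos 1).le,
          ← Real.exp_mul, one_mul, Real.exp_neg, mul_comm, div_eq_mul_inv]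
    _ ≤ ∫ x in Set.Ioi s, Real.exp (-x) * x ^ s := by
        refine setIntegral_mono_on ?_ (hint.mono_set (Set.Ioi_subset_Ioi hs.le)) measurableSet_Ioi
          fun x hx => ?_
        · exact (integrableOn_exp_neg_Ioi s).mul_const _
        · have : s ≤ x := le_of_lt hx
          gcongr
    _ ≤ ∫ x in Set.Ioi 0, Real.exp (-x) * x ^ s := by
        refine setIntegral_mono_set hint ?_ (Set.Ioi_subset_Ioi hs.le).eventuallyLE
        filter_upwards [ae_restrict_mem measurableSet_Ioi] with x hx
        have : (0 : ℝ) < x := hx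
        positivity

lemma volume_sum_sq_le {d : ℕ} (hd : 0 < d) {s : ℝ} (hs : 0 ≤ s) :
    volume {x : Fin d → ℝ | ∑ i, x i ^ 2 ≤ s} ≤
      ENNReal.ofReal ((2 * Real.pi * Real.exp 1 * s / d) ^ ((d : ℝ) / 2)) := by
  have hd' : (0 : ℝ) < d := by exact_mod_cast hd
  have : Nonempty (Fin d) := ⟨⟨0, hd⟩⟩
  have h := EuclideanSpace.volume_closedBall (Fin d) 0 √s
  have hpre : (WithLp.toLp 2 : (Fin d → ℝ) → EuclideanSpace ℝ (Fin d)) ⁻¹'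
      Metric.closedBall 0 √s = {x : Fin d → ℝ | ∑ i, x i ^ 2 ≤ s} := by
    ext x
    change WithLp.toLp 2 x ∈ Metric.closedBall 0 √s ↔ ∑ i, x i ^ 2 ≤ s
    rw [mem_closedBall_zero_iff, EuclideanSpace.norm_eq]
    simp only [Real.norm_eq_abs, sq_abs]
    exact Real.sqrt_le_sqrt_iff hs
  rw [← (PiLp.volume_preserving_toLp (Fin d)).measure_preimage
    measurableSet_closedBall.nullMeasurableSet, hpre] at h
  rw [h, Fintype.card_fin, ← ENNReal.ofReal_pow (by positivity), ← ENNReal.ofReal_mul (by positivity)]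
  refine ENNReal.ofReal_le_ofReal ?_
  have h1 := rpow_div_exp_le_Gamma (s := (d : ℝ) / 2) (by positivity)
  have h2 : √s ^ d * √Real.pi ^ d = (s * Real.pi) ^ ((d : ℝ) / 2) := by
    rw [← mul_pow, ← Real.sqrt_mul hs, Real.sqrt_eq_rpow, ← Real.rpow_natCast, ← Real.rpow_mul
      (by positivity)]
    congr 1; ring
  calc √s ^ d * (√Real.pi ^ d / Real.Gamma ((d : ℝ) / 2 + 1))
      = (s * Real.pi) ^ ((d : ℝ) / 2) / Real.Gamma ((d : ℝ) / 2 + 1) := by rw [← h2]; ring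
    _ ≤ (s * Real.pi) ^ ((d : ℝ) / 2) / ((d : ℝ) / 2 / Real.exp 1) ^ ((d : ℝ) / 2) := by
        gcongr
    _ = _ := by
        rw [← Real.div_rpow (by positivity) (by positivity)]
        congr 1; field_simp

/-! ### One step of the construction -/

/-- The width of the spherical shells used to build sets of size about `N` from `d`-dimensional
balls. -/
noncomputable def shellWidth (D d : ℕ) (N : ℝ) : ℝ :=
  d / (2 * Real.pi * Real.exp 1 * D) * (2 ^ (D + 1) * N) ^ (-2 / (d : ℝ))

lemma shellWidth_pos {D d : ℕ} {N : ℝ} (hD : 0 < D) (hd : 0 < d) (hN : 0 < N) :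
    0 < shellWidth D d N := by
  unfold shellWidth; positivity

/-- The width is tuned so that the upper bound for the ball volume is exactly `1 / (2^(D+1) N)`; the
at most `2^D N` multiples then have total measure at most `1/2`. -/
lemma mul_volume_shellWidth_lt {D d : ℕ} {N : ℝ} (hD : 0 < D) (hd : 0 < d) (hN : 0 < N) :
    (2 ^ D * ⌊N⌋₊ : ℕ) * volume {x : Fin d → ℝ | ∑ i, x i ^ 2 ≤ D * shellWidth D d N} < 1 := by
  have hτ := shellWidth_pos hD hd hN
  have hd' : (0 : ℝ) < d := by exact_mod_cast hd
  have hD' : (0 : ℝ) < D := by exact_mod_cast hD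
  refine (mul_le_mul_right (volume_sum_sq_le hd (by positivity)) _).trans_lt ?_
  have h1 : 2 * Real.pi * Real.exp 1 * (D * shellWidth D d N) / d =
      (2 ^ (D + 1) * N) ^ (-2 / (d : ℝ)) := by
    unfold shellWidth; field_simp
  rw [h1, ← Real.rpow_mul (by positivity), show -2 / (d : ℝ) * (d / 2) = -1 by field_simp,
    Real.rpow_neg_one, ← ENNReal.ofReal_natCast, ← ENNReal.ofReal_mul (by positivity),
    ENNReal.ofReal_lt_one, ← div_eq_mul_inv, div_lt_one (by positivity), pow_succ]
  push_cast
  have h2 := Nat.floor_le hN.le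
  have h3 : (0 : ℝ) < 2 ^ D := by positivity
  nlinarith

theorem exists_isFree_of_nearConst {k D d : ℕ} (hk : 2 * D < k) (hD : 0 < D) (hd : 0 < d) {N : ℝ}
    (hN : 0 < N) {T : Set ℝ} (hTm : MeasurableSet T) {w a b : ℝ} (hw : 0 ≤ w)
    (hTw : T ⊆ Set.Icc 0 w) (hab : a < b)
    (hT : ∀ c, NearConst k (2 * D) {s | s - c ∈ T} (shellWidth D d N)) :
    ∃ A ⊆ Icc 1 (⌊N⌋₊ : ℤ), IsFree k D A ∧
      ⌊N⌋₊ * ((1 / 2) ^ (D * d) * (4 ^ (D + 1) * volume.real T * (sqSumLaw d).real (Set.Icc a b) /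
        (b - a + 4 ^ (D + 1) * w))) ≤ A.card := by
  set r : ℝ := (1 / 4) ^ (D + 1) with hr
  have hr0 : 0 < r := by positivity
  have hr4 : r⁻¹ = 4 ^ (D + 1) := by rw [hr, ← inv_pow]; norm_num
  have hT1 : MeasurableSet {s | r * s ∈ T} := hTm.preimage (f := fun s => r * s) (by fun_prop)
  obtain ⟨c, hc⟩ := exists_mul_le_measure_shift (sqSumLaw d) hT1 (w := r⁻¹ * w) (a := a) (b := b)
    (fun s hs => by
      have := hTw hs
      rw [Set.mem_Icc, ← div_eq_inv_mul, le_div_iff₀' hr0]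
      exact ⟨le_of_mul_le_mul_left (by linarith [this.1]) hr0, this.2⟩) hab (by positivity)
  have hT2 : MeasurableSet {t | t - r * c ∈ T} :=
    hTm.preimage (f := fun t => t - r * c) (by fun_prop)
  obtain ⟨A, hA, hfree, hcard⟩ := exists_isFree_card_ge (M := ⌊N⌋₊) hk hT2 (hT (r * c))
    (mul_volume_shellWidth_lt hD hd hN)
  refine ⟨A, hA, hfree, ?_⟩
  rw [volume_cubeSet hT2] at hcard
  have hset : {s | (1 / 4) ^ (D + 1) * s ∈ {t | t - r * c ∈ T}} = {s | s - c ∈ {s | r * s ∈ T}} := by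
    ext s
    change r * s - r * c ∈ T ↔ r * (s - c) ∈ T
    rw [mul_sub]
  rw [hset] at hcard
  have hvol : volume {s | r * s ∈ T} = ENNReal.ofReal r⁻¹ * volume T := by
    have := Real.volume_preimage_mul_left hr0.ne' T
    rwa [abs_of_pos (inv_pos.mpr hr0)] at this
  have h1 := ENNReal.toReal_mono (by simp) hcard
  have h2 := ENNReal.toReal_mono (ENNReal.mul_ne_top (by simp) (measure_ne_top _ _)) hc
  rw [hvol] at h2
  simp only [ENNReal.toReal_mul, ENNReal.toReal_natCast, ENNReal.toReal_pow, ENNReal.toReal_inv,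
    ENNReal.toReal_ofNat, ← measureReal_def] at h1 h2
  have hpos : 0 < b - a + r⁻¹ * w := by
    have : 0 ≤ r⁻¹ * w := by positivity
    linarith
  rw [ENNReal.toReal_ofReal (by positivity), ENNReal.toReal_ofReal hpos.le] at h2
  rw [← hr4]
  refine le_trans ?_ h1
  rw [one_div]
  gcongr
  rwa [div_le_iff₀' hpos]

theorem exists_isFree_shell {k d : ℕ} (hk : 3 ≤ k) (hd : 0 < d) {N : ℝ} (hN : 0 < N) {a b : ℝ}
    (hab : a < b) : ∃ A ⊆ Icc 1 (⌊N⌋₊ : ℤ), IsFree k 1 A ∧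
      ⌊N⌋₊ * ((1 / 2) ^ d * (16 * shellWidth 1 d N * (sqSumLaw d).real (Set.Icc a b) /
        (b - a + 16 * shellWidth 1 d N))) ≤ A.card := by
  have hτ := shellWidth_pos (D := 1) one_pos hd hN
  obtain ⟨A, hA, hfree, hcard⟩ := exists_isFree_of_nearConst (k := k) (D := 1) (d := d) (N := N)
    (T := Set.Icc 0 (shellWidth 1 d N)) (w := shellWidth 1 d N) (by lia) one_pos hd hN
    measurableSet_Icc hτ.le le_rfl hab fun c => by
      convert nearConst_Icc k (2 * 1) c (shellWidth 1 d N) using 1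
      ext s
      change (0 ≤ s - c ∧ s - c ≤ _) ↔ (c ≤ s ∧ s ≤ _)
      constructor <;> rintro ⟨h1, h2⟩ <;> constructor <;> linarith
  refine ⟨A, hA, hfree, ?_⟩
  rw [Real.volume_real_Icc_of_le hτ.le, one_mul, sub_zero] at hcard
  norm_num at hcard ⊢
  exact hcard

lemma measureReal_biUnion_Icc {A : Finset ℤ} {δ η : ℝ} (hδ : 0 < δ) (hη0 : 0 ≤ η) (hη1 : η < 1) :
    volume.real (⋃ a ∈ A, Set.Icc (δ * a) (δ * (a + η))) = A.card * (δ * η) := by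
  rw [measureReal_biUnion_finset _ (fun _ _ => measurableSet_Icc)
    fun _ _ => isCompact_Icc.measure_ne_top]
  · rw [sum_congr rfl fun (a : ℤ) _ =>
      Real.volume_real_Icc_of_le (by nlinarith : δ * (a : ℝ) ≤ δ * (a + η))]
    simp [mul_add]
  · intro x _ y _ hxy
    refine Set.disjoint_left.mpr fun z hx hy => hxy ?_
    have h1 : (x : ℝ) ≤ y + η := le_of_mul_le_mul_left (hx.1.trans hy.2) hδ
    have h2 : (y : ℝ) ≤ x + η := le_of_mul_le_mul_left (hy.1.trans hx.2) hδ
    have h3 : (x : ℝ) < y + 1 := by linarith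
    have h4 : (y : ℝ) < x + 1 := by linarith
    have h5 : x < y + 1 := by exact_mod_cast h3
    have h6 : y < x + 1 := by exact_mod_cast h4
    lia

theorem exists_isFree_step {k D d : ℕ} (hk : 2 * D < k) (hD : 0 < D) (hd : 0 < d) {N N₀ : ℝ}
    (hN : 0 < N) (hN₀ : 1 ≤ N₀) {A₀ : Finset ℤ} (hA₀ : A₀ ⊆ Icc 1 (⌊N₀⌋₊ : ℤ))
    (hfree₀ : IsFree k (2 * D) A₀) {a b : ℝ} (hab : a < b) {η : ℝ} (hη : 0 < η)
    (hηD : 2 ^ (2 * D) * η < 1) : ∃ A ⊆ Icc 1 (⌊N⌋₊ : ℤ), IsFree k D A ∧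
      ⌊N⌋₊ * ((1 / 2) ^ (D * d) * (4 ^ (D + 1) * (A₀.card * shellWidth D d N) *
        (sqSumLaw d).real (Set.Icc a b) /
        (b - a + 4 ^ (D + 1) * (shellWidth D d N / η * (2 * N₀))))) ≤ A.card := by
  have hτ := shellWidth_pos hD hd hN
  set δ := shellWidth D d N / η with hδ
  have hδ0 : 0 < δ := by positivity
  have hδη : δ * η = shellWidth D d N := by rw [hδ]; field_simp
  have hη1 : η < 1 := by
    have : (1 : ℝ) ≤ 2 ^ (2 * D) := one_le_pow₀ (by norm_num)
    nlinarith
  have h := exists_isFree_of_nearConst (k := k) (D := D) (d := d) (N := N) (a := a) (b := b)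
    (T := ⋃ a ∈ A₀, Set.Icc (δ * a) (δ * (a + η))) (w := δ * (2 * N₀)) hk hD hd hN
    (Finset.measurableSet_biUnion _ fun _ _ => measurableSet_Icc) (by positivity) (fun s hs => by
      obtain ⟨x, hx, h1, h2⟩ := Set.mem_iUnion₂.mp hs
      obtain ⟨h3, h4⟩ := mem_Icc.mp (hA₀ hx)
      have h5 : (1 : ℝ) ≤ x := by exact_mod_cast h3
      have h6 : (x : ℝ) ≤ ⌊N₀⌋₊ := by exact_mod_cast h4
      have h7 := Nat.floor_le (zero_le_one.trans hN₀)
      -- `N₀ ≥ 1 > η` lets `2 * N₀` absorb the thickening by `η`.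
      have h8 : δ * (x + η) ≤ δ * (2 * N₀) := by gcongr; linarith
      exact ⟨le_trans (by positivity) h1, h2.trans h8⟩) hab fun c => by
      have := hfree₀.nearConst (c := c) hδ0 hηD
      rw [hδη] at this
      convert this using 1
      ext s
      change s - c ∈ (⋃ a ∈ A₀, Set.Icc (δ * (a : ℝ)) (δ * (a + η))) ↔ _
      simp only [Set.mem_iUnion, Set.mem_Icc, exists_prop]
      refine exists_congr fun x => and_congr_right fun _ => ?_
      constructor <;> rintro ⟨h1, h2⟩ <;> constructor <;> linarith
  rwa [measureReal_biUnion_Icc hδ0 hη.le hη1, hδη] at h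

/-! ### Recursion for densities -/

/-- For every `N ≥ 1` there are sets of integers in `[1, N]` without nonconstant `k`-term
progressions of degree at most `D` whose density is at least `C * G (log₂ N)`. -/
def HasFreeDensity (k D : ℕ) (G : ℝ → ℝ) : Prop :=
  ∃ C : ℝ, 0 < C ∧ ∀ N : ℝ, 1 ≤ N → ∃ A ⊆ Icc 1 (⌊N⌋₊ : ℤ), IsFree k D A ∧
    C * N * G (Real.logb 2 N) ≤ A.card

lemma half_le_floor {N : ℝ} (hN : 1 ≤ N) : N / 2 ≤ ⌊N⌋₊ := by
  have h1 := Nat.lt_floor_add_one N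
  have h2 : (1 : ℝ) ≤ ⌊N⌋₊ := by exact_mod_cast Nat.le_floor (by simpa using hN)
  linarith

lemma singleton_one_subset {N : ℝ} (hN : 1 ≤ N) : ({1} : Finset ℤ) ⊆ Icc 1 (⌊N⌋₊ : ℤ) := by
  have h2 : 1 ≤ ⌊N⌋₊ := Nat.le_floor (by simpa using hN)
  simp; lia

/-- A window of length `2 √d` around the mean carries a mass bounded below uniformly in large `d`.
-/
lemma exists_eventually_le_sqSumLaw : ∃ p : ℝ, 0 < p ∧ ∃ d₁ : ℕ, ∀ d ≥ d₁,
    p ≤ (sqSumLaw d).real (Set.Icc (d / 3 - 1 * √d) (d / 3 + 1 * √d)) := by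
  have h := le_gaussianReal_Icc (v := 4 / 45) (by norm_num) 1
  set q := (√(2 * Real.pi * (4 / 45 : NNReal)))⁻¹ *
    Real.exp (-1 ^ 2 / (2 * (4 / 45 : NNReal))) * (2 * 1) with hq
  have hv : (0 : ℝ) < (4 / 45 : NNReal) := by norm_num
  have hq0 : 0 < q := by positivity
  have h1 := (tendsto_sqSumLaw_Icc (η := 1)).eventually
    (lt_mem_nhds ((half_lt_self hq0).trans_le h))
  obtain ⟨d₁, hd₁⟩ := eventually_atTop.mp h1
  exact ⟨q / 2, by positivity, d₁, fun d hd => (hd₁ d hd).le⟩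

lemma shellWidth_le {D d : ℕ} {N : ℝ} (hN : 0 < N) :
    shellWidth D d N ≤ d / (2 * Real.pi * Real.exp 1 * D) * N ^ (-2 / (d : ℝ)) := by
  unfold shellWidth
  refine mul_le_mul_of_nonneg_left ?_ (by positivity)
  refine Real.rpow_le_rpow_of_nonpos hN ?_
    (div_nonpos_of_nonpos_of_nonneg (neg_nonpos.mpr zero_le_two) (by positivity))
  have : (1 : ℝ) ≤ 2 ^ (D + 1) := one_le_pow₀ (by norm_num)
  nlinarith

lemma le_shellWidth {D d : ℕ} {N : ℝ} (hd : 0 < d) (hN : 0 < N) :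
    d / (2 * Real.pi * Real.exp 1 * D) * ((1 / 4) ^ (D + 1) * N ^ (-2 / (d : ℝ))) ≤
      shellWidth D d N := by
  unfold shellWidth
  rw [Real.mul_rpow (by positivity) hN.le]
  gcongr
  have hd' : (1 : ℝ) ≤ d := by exact_mod_cast hd
  have h1 : ((1 : ℝ) / 4) ^ (D + 1) = (2 ^ (D + 1)) ^ (-2 : ℝ) := by
    rw [Real.rpow_neg (by positivity), one_div, inv_pow, Real.rpow_ofNat, ← pow_mul,
      mul_comm (D + 1), pow_mul]
    norm_num
  rw [h1]
  refine Real.rpow_le_rpow_of_exponent_le (one_le_pow₀ (by norm_num)) ?_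
  rw [le_div_iff₀ (by positivity)]
  linarith

/-- `N₀` is taken as large as possible, up to a constant, while the dilated copy of `A₀` still fits
in a width comparable to the window `√d`. Then `N₀` times the shell width is of order `√d`, so only
the cube factor and the density of `A₀` are lost. -/
theorem HasFreeDensity.step {k D : ℕ} (hk : 2 * D < k) (hD : 0 < D) {G : ℝ → ℝ}
    (hG : HasFreeDensity k (2 * D) G) : ∃ c c₁ : ℝ, 0 < c ∧ 0 < c₁ ∧ c₁ ≤ 1 ∧ ∃ d₁ : ℕ,
      ∀ d ≥ d₁, ∀ N : ℝ, 1 ≤ N → 1 ≤ c₁ * N ^ (2 / (d : ℝ)) / √d →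
        ∃ A ⊆ Icc 1 (⌊N⌋₊ : ℤ), IsFree k D A ∧
          c * N * (1 / 2) ^ (D * d) * G (Real.logb 2 (c₁ * N ^ (2 / (d : ℝ)) / √d)) ≤ A.card := by
  obtain ⟨p, hp, d₁, hd₁⟩ := exists_eventually_le_sqSumLaw
  obtain ⟨C, hC, hG⟩ := hG
  set κ : ℝ := 1 / (2 * Real.pi * Real.exp 1 * D) with hκ
  have hD' : (0 : ℝ) < D := by exact_mod_cast hD
  have hκ0 : 0 < κ := by positivity
  set η : ℝ := (1 / 2) ^ (2 * D + 1) with hη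
  have hη0 : 0 < η := by positivity
  have hηD : 2 ^ (2 * D) * η < 1 := by
    rw [hη, pow_succ, ← mul_assoc, ← mul_pow]; norm_num
  -- The second entry makes the rescaled width of the dilated set at most `√d`, so the denominator
  -- is at most `2 √d + √d`.
  set c₁ : ℝ := min 1 (η / (2 * 4 ^ (D + 1) * κ)) with hc₁
  have hc₁0 : 0 < c₁ := by positivity
  refine ⟨1 / 2 * (κ * p / 3) * (c₁ * C), c₁, by positivity, hc₁0, min_le_left _ _, max d₁ 1,
    fun d hd N hN hN₀ => ?_⟩
  have hN0 : 0 < N := by linarith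
  have hd0 : 0 < d := by have := le_of_max_le_right hd; lia
  have hd0' : (0 : ℝ) < d := by exact_mod_cast hd0
  have hsq : 0 < √(d : ℝ) := Real.sqrt_pos.mpr hd0'
  have hsq2 : √(d : ℝ) * √d = d := Real.mul_self_sqrt hd0'.le
  set N₀ := c₁ * N ^ (2 / (d : ℝ)) / √d with hN₀def
  obtain ⟨A₀, hA₀, hfree₀, hcard₀⟩ := hG N₀ hN₀
  obtain ⟨A, hA, hfree, hcard⟩ := exists_isFree_step hk hD hd0 hN0 hN₀ hA₀ hfree₀
    (a := d / 3 - 1 * √d) (b := d / 3 + 1 * √d) (by linarith) hη0 hηD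
  refine ⟨A, hA, hfree, le_trans ?_ hcard⟩
  have hτ := shellWidth_pos hD hd0 hN0
  have hτ1 := shellWidth_le (D := D) (d := d) hN0
  have hτ2 := le_shellWidth (D := D) hd0 hN0
  have hNinv : N ^ (-2 / (d : ℝ)) * N ^ (2 / (d : ℝ)) = 1 := by
    rw [← Real.rpow_add hN0, neg_div, neg_add_cancel, Real.rpow_zero]
  set τ := shellWidth D d N
  set X := N ^ (2 / (d : ℝ)) with hX
  set Y := N ^ (-2 / (d : ℝ)) with hY
  have hX0 : 0 < X := by positivity
  have hY0 : 0 < Y := by positivity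
  have hden : d / 3 + 1 * √(d : ℝ) - (d / 3 - 1 * √d) + 4 ^ (D + 1) * (τ / η * (2 * N₀)) ≤
      3 * √d := by
    have h1 : c₁ ≤ η / (2 * 4 ^ (D + 1) * κ) := min_le_right _ _
    have h2 : 4 ^ (D + 1) * (τ / η * (2 * N₀)) ≤
        4 ^ (D + 1) * (d * κ * Y / η * (2 * (η / (2 * 4 ^ (D + 1) * κ) * X / √d))) := by
      have h3 : τ ≤ d * κ * Y := hτ1.trans_eq (by rw [hκ]; ring)
      have h4 : N₀ ≤ η / (2 * 4 ^ (D + 1) * κ) * X / √d := by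
        rw [hN₀def]; gcongr
      gcongr
    have h5 : 4 ^ (D + 1) * (d * κ * Y / η * (2 * (η / (2 * 4 ^ (D + 1) * κ) * X / √d))) =
        √(d : ℝ) := by
      calc _ = (Y * X) * (√(d : ℝ) * √d) / √d := by rw [hsq2]; field_simp
        _ = √d := by rw [hNinv]; field_simp
    linarith
  have hden0 : 0 < d / 3 + 1 * √(d : ℝ) - (d / 3 - 1 * √d) +
      4 ^ (D + 1) * (τ / η * (2 * N₀)) := by
    have : 0 ≤ 4 ^ (D + 1) * (τ / η * (2 * N₀)) := by positivity
    linarith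
  have hτ3 : κ * (√d * √d) * Y ≤ 4 ^ (D + 1) * τ := by
    calc κ * (√d * √d) * Y = 4 ^ (D + 1) * (d / (2 * Real.pi * Real.exp 1 * D) *
          ((1 / 4) ^ (D + 1) * Y)) := by
          rw [hsq2, hκ, one_div_pow]; field_simp
      _ ≤ _ := by gcongr
  calc 1 / 2 * (κ * p / 3) * (c₁ * C) * N * (1 / 2) ^ (D * d) * G (Real.logb 2 N₀)
      = N / 2 * ((1 / 2) ^ (D * d) * (κ * (√d * √d) * Y * (C * N₀ * G (Real.logb 2 N₀)) * p /
          (3 * √d))) := by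
        rw [hN₀def]
        have : κ * (√d * √d) * Y * (C * (c₁ * X / √d) * G (Real.logb 2 (c₁ * X / √d))) * p /
          (3 * √d) = (Y * X) * (κ * p / 3 * c₁ * C * G (Real.logb 2 (c₁ * X / √d))) := by
          field_simp
        rw [this, hNinv]; ring
    _ ≤ N / 2 * ((1 / 2) ^ (D * d) * (κ * (√d * √d) * Y * A₀.card * p / (3 * √d))) := by
        gcongr
    _ ≤ ⌊N⌋₊ * ((1 / 2) ^ (D * d) * (4 ^ (D + 1) * τ * A₀.card * p / (3 * √d))) := by
        gcongr
        exact half_le_floor hN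
    _ = ⌊N⌋₊ * ((1 / 2) ^ (D * d) * (4 ^ (D + 1) * (A₀.card * τ) * p / (3 * √d))) := by ring
    _ ≤ _ := by
        gcongr
        exact hd₁ d (le_of_max_le_left hd)

/-! ### Optimising the dimension -/

lemma eventually_add_mul_log_le (A B : ℝ) {c γ : ℝ} (hc : 0 < c) (hγ : 0 < γ) :
    ∀ᶠ L : ℝ in atTop, A + B * Real.log L ≤ c * L ^ γ := by
  have h1 := ((isLittleO_log_rpow_atTop hγ).const_mul_left B).bound (half_pos hc)
  have h2 := ((tendsto_rpow_atTop hγ).const_mul_atTop (half_pos hc)).eventually_ge_atTop A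
  filter_upwards [h1, h2, eventually_ge_atTop 0] with L h1 h2 h3
  have h4 := (Real.le_norm_self _).trans h1
  rw [Real.norm_of_nonneg (by positivity)] at h4
  linarith

/-- For bounded `N` the profile is bounded, and a small constant lets `{1}` suffice. -/
lemma hasFreeDensity_of_eventually {k D : ℕ} {G : ℝ → ℝ}
    (hG : ∀ L₁, ∃ B, ∀ L, 0 ≤ L → L ≤ L₁ → G L ≤ B)
    (h : ∃ C : ℝ, 0 < C ∧ ∀ᶠ L : ℝ in atTop, ∀ N : ℝ, 1 ≤ N → L = Real.logb 2 N →
      ∃ A ⊆ Icc 1 (⌊N⌋₊ : ℤ), IsFree k D A ∧ C * N * G L ≤ A.card)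
    (hG0 : ∀ L, 0 ≤ L → 0 ≤ G L) : HasFreeDensity k D G := by
  obtain ⟨C, hC, h⟩ := h
  obtain ⟨L₁, hL₁⟩ := eventually_atTop.mp h
  obtain ⟨B, hB⟩ := hG L₁
  have hB' : B ≤ max B 1 := le_max_left _ _
  have hB0 : 0 < max B 1 := by positivity
  refine ⟨min C (1 / (2 ^ L₁ * max B 1)), by positivity, fun N hN => ?_⟩
  have hL0 : 0 ≤ Real.logb 2 N := Real.logb_nonneg (by norm_num) hN
  have hG0' := hG0 _ hL0
  rcases le_or_gt L₁ (Real.logb 2 N) with hL | hL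
  · obtain ⟨A, hA, hfree, hcard⟩ := hL₁ _ hL N hN rfl
    refine ⟨A, hA, hfree, le_trans ?_ hcard⟩
    gcongr
    exact min_le_left _ _
  · refine ⟨{1}, singleton_one_subset hN, isFree_singleton _ _ _, ?_⟩
    have hN2 : N ≤ 2 ^ L₁ := by
      rw [← Real.logb_le_iff_le_rpow (by norm_num) (by linarith)]; exact hL.le
    calc min C (1 / (2 ^ L₁ * max B 1)) * N * G (Real.logb 2 N)
        ≤ 1 / (2 ^ L₁ * max B 1) * 2 ^ L₁ * max B 1 := by
          gcongr
          · exact min_le_right _ _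
          · exact (hB _ hL0 hL.le).trans hB'
      _ = 1 := by field_simp
      _ = _ := by simp

/-- The dimension `2 ^ ((n - 1) / 2) * (L / D) ^ (1 / n)` that balances the construction. -/
noncomputable def optDim (n : ℕ) (D L : ℝ) : ℝ :=
  2 ^ (((n : ℝ) - 1) / 2) * (L / D) ^ (1 / (n : ℝ))

/-- The density `L ^ (1 / (2 n)) / 2 ^ (n D d)`, with `d` the optimal dimension. -/
noncomputable def densityProfile (n : ℕ) (D : ℝ) (L : ℝ) : ℝ :=
  L ^ (1 / (2 * (n : ℝ))) * 2 ^ (-(n * D * optDim n D L))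

theorem HasFreeDensity.densityProfile {k D n : ℕ} (hn : 2 ≤ n) (hk : 2 * D < k) (hD : 0 < D)
    {G : ℝ → ℝ} (hG : HasFreeDensity k (2 * D) G)
    (hGle : ∀ c₁ : ℝ, 0 < c₁ → c₁ ≤ 1 → ∃ κ : ℝ, 0 < κ ∧ ∀ (L L₀ : ℝ) (d : ℕ), 0 < L → 0 < d →
      optDim n D L ≤ d → L₀ = 2 * L / d - Real.logb 2 d / 2 + Real.logb 2 c₁ →
      L / (2 * optDim n D L) ≤ L₀ →
      κ * (L ^ (1 / (2 * (n : ℝ))) * 2 ^ (-((n - 1) * D * optDim n D L))) ≤ G L₀) :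
    HasFreeDensity k D (densityProfile n D) := by
  obtain ⟨c, c₁, hc, hc₁, hc₁1, d₁, hstep⟩ := hG.step hk hD
  obtain ⟨κ, hκ, hGle⟩ := hGle c₁ hc₁ hc₁1
  have hD' : (0 : ℝ) < D := by exact_mod_cast hD
  have hn' : (0 : ℝ) < n := by exact_mod_cast (by lia : 0 < n)
  have hn2 : (2 : ℝ) ≤ n := by exact_mod_cast hn
  have hopt0 : ∀ L : ℝ, 0 ≤ L → 0 ≤ optDim n D L := fun L hL => by unfold optDim; positivity
  refine hasFreeDensity_of_eventually (fun L₁ => ⟨L₁ ^ (1 / (2 * (n : ℝ))) * 1, fun L hL hL₁ => ?_⟩)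
    ⟨c * (1 / 2) ^ D * κ, by positivity, ?_⟩ fun L hL => by unfold _root_.densityProfile; positivity
  · have := hopt0 L hL
    unfold _root_.densityProfile
    have h1 : 0 ≤ n * D * optDim n D L := by positivity
    have h2 : 0 ≤ L₁ := hL.trans hL₁
    gcongr
    exact Real.rpow_le_one_of_one_le_of_nonpos one_le_two (neg_nonpos.mpr h1)
  set β : ℝ := 2 ^ (((n : ℝ) - 1) / 2) * (1 / D) ^ (1 / (n : ℝ)) with hβ
  have hβ0 : 0 < β := by positivity
  have hopt : ∀ L : ℝ, 0 ≤ L → optDim n D L = β * L ^ (1 / (n : ℝ)) := fun L hL => by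
    rw [optDim, hβ, mul_assoc, ← Real.mul_rpow (by positivity) hL]; congr 2; ring
  have htend : Tendsto (optDim n D) atTop atTop := by
    refine ((tendsto_rpow_atTop (by positivity : 0 < 1 / (n : ℝ))).const_mul_atTop hβ0).congr' ?_
    filter_upwards [eventually_ge_atTop 0] with L hL using (hopt L hL).symm
  -- With `d` of order `L^(1/n)`, the logarithmic corrections to `2L/d` are dominated by `L / (2
  -- d₀)`, which is a constant times `L^(1 - 1/n)`.
  have hlog := eventually_add_mul_log_le
    (Real.log (2 * β) / Real.log 2 / 2 - Real.logb 2 c₁) (1 / n / Real.log 2 / 2)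
    (c := 1 / (2 * β)) (γ := 1 - 1 / n) (by positivity) (by
      rw [sub_pos, div_lt_one hn']; linarith)
  filter_upwards [htend.eventually_ge_atTop (max d₁ 1), hlog, eventually_gt_atTop 0]
    with L hd₀ hlog hL N hN hLN
  have hN0 : 0 < N := by linarith
  set d₀ := optDim n D L with hd₀def
  have hd₀1 : 1 ≤ d₀ := (le_max_right _ _).trans hd₀
  have hdle : d₀ ≤ ⌈d₀⌉₊ := Nat.le_ceil _
  have hdlt : (⌈d₀⌉₊ : ℝ) < d₀ + 1 := Nat.ceil_lt_add_one (by linarith)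
  set d := ⌈d₀⌉₊
  have hd0 : (0 : ℝ) < d := by linarith
  have hdd₁ : d₁ ≤ d := by exact_mod_cast ((le_max_left _ _).trans hd₀).trans hdle
  set N₀ := c₁ * N ^ (2 / (d : ℝ)) / √d with hN₀
  have hN₀0 : 0 < N₀ := by positivity
  have hL₀ : Real.logb 2 N₀ = 2 * L / d - Real.logb 2 d / 2 + Real.logb 2 c₁ := by
    rw [hN₀, Real.logb_div (by positivity) (by positivity), Real.logb_mul (by positivity)
      (by positivity), Real.logb_rpow_eq_mul_logb_of_pos hN0, Real.sqrt_eq_rpow,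
      Real.logb_rpow_eq_mul_logb_of_pos hd0, ← hLN]
    ring
  have hL₀ge : L / (2 * d₀) ≤ Real.logb 2 N₀ := by
    have h1 : Real.logb 2 d ≤ Real.log (2 * β) / Real.log 2 + 1 / n * Real.log L / Real.log 2 := by
      rw [← add_div, ← Real.log_rpow hL, ← Real.log_mul (by positivity) (by positivity), mul_assoc,
        ← hopt L hL.le, Real.logb]
      have h0 : (0 : ℝ) ≤ Real.log 2 := Real.log_nonneg (by norm_num)
      have h1 : (d : ℝ) ≤ 2 * d₀ := by linarith
      gcongr
    have h2 : 1 / (2 * β) * L ^ (1 - 1 / (n : ℝ)) = L / (2 * d₀) := by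
      rw [hd₀def, hopt L hL.le, Real.rpow_sub hL, Real.rpow_one]; field_simp
    have h3 : L / d₀ ≤ 2 * L / d := by
      rw [div_le_div_iff₀ (by linarith) hd0]; nlinarith
    have h4 : L / d₀ = L / (2 * d₀) + L / (2 * d₀) := by field_simp; norm_num
    rw [h2] at hlog
    rw [hL₀]
    have h5 : 1 / n / Real.log 2 / 2 * Real.log L = 1 / n * Real.log L / Real.log 2 / 2 := by ring
    linarith
  have hN₀1 : 1 ≤ N₀ := by
    have : 0 ≤ Real.logb 2 N₀ := le_trans (by positivity) hL₀ge
    rwa [Real.logb_nonneg_iff (by norm_num) hN₀0] at this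
  obtain ⟨A, hA, hfree, hcard⟩ := hstep d hdd₁ N hN hN₀1
  refine ⟨A, hA, hfree, le_trans ?_ hcard⟩
  have hGL := hGle L (Real.logb 2 N₀) d hL (by exact_mod_cast hd0) hdle hL₀ hL₀ge
  -- Rounding the dimension up costs at most the constant factor `2^(-D)`.
  have h2 : (2 : ℝ) ^ (-(D * d₀)) * (1 / 2) ^ D ≤ (1 / 2) ^ (D * d) := by
    have h3 : ∀ m : ℕ, ((1 : ℝ) / 2) ^ m = 2 ^ (-(m : ℝ)) := fun m => by
      rw [Real.rpow_neg (by norm_num), Real.rpow_natCast, one_div, inv_pow]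
    rw [h3, h3, ← Real.rpow_add (by norm_num)]
    refine Real.rpow_le_rpow_of_exponent_le (by norm_num) ?_
    push_cast
    nlinarith
  calc c * (1 / 2) ^ D * κ * N * _root_.densityProfile n D L
      = c * N * (2 ^ (-(D * d₀)) * (1 / 2) ^ D) *
          (κ * (L ^ (1 / (2 * (n : ℝ))) * 2 ^ (-((n - 1) * D * d₀)))) := by
        rw [_root_.densityProfile, ← hd₀def, show -(n * D * d₀) =
          -(D * d₀) + -((n - 1) * D * d₀) by ring, Real.rpow_add (by norm_num)]
        ring
    _ ≤ c * N * (1 / 2) ^ (D * d) * G (Real.logb 2 N₀) := by gcongr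

theorem hasFreeDensity_singleton (k D : ℕ) : HasFreeDensity k D fun L => 2 ^ (-L) := by
  refine ⟨1, one_pos, fun N hN => ⟨{1}, singleton_one_subset hN, isFree_singleton _ _ _, ?_⟩⟩
  have hN0 : 0 < N := by linarith
  change 1 * N * (2 : ℝ) ^ (-Real.logb 2 N) ≤ _
  rw [Real.rpow_neg (by norm_num), Real.rpow_logb (by norm_num) (by norm_num) hN0, one_mul,
    mul_inv_cancel₀ hN0.ne']
  simp

/-- The balance behind `optDim`: with `d` the current dimension and `d'` the next, `2D d' = D d`.
All levels contribute equally, and `D d + n (2D) d' = (n + 1) D d`. Taking logarithms makes the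
identity linear. -/
lemma optDim_step {n : ℕ} (hn : 1 ≤ n) {D L : ℝ} (hD : 0 < D) (hL : 0 < L) :
    2 * D * optDim n (2 * D) (2 * L / optDim (n + 1) D L) = D * optDim (n + 1) D L := by
  have hn' : (0 : ℝ) < n := by exact_mod_cast hn
  have h2 := Real.log_pos (by norm_num : (1 : ℝ) < 2)
  have h0 : 0 < optDim (n + 1) D L := by unfold optDim; positivity
  have h1 : 0 < optDim n (2 * D) (2 * L / optDim (n + 1) D L) := by
    rw [optDim]; positivity
  refine Real.log_injOn_pos (by simp only [Set.mem_Ioi]; positivity)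
    (by simp only [Set.mem_Ioi]; positivity) ?_
  have hl : Real.log (optDim (n + 1) D L) =
      ((n + 1 : ℝ) - 1) / 2 * Real.log 2 + 1 / (n + 1 : ℝ) * (Real.log L - Real.log D) := by
    rw [optDim, Real.log_mul (by positivity) (by positivity), Real.log_rpow (by norm_num),
      Real.log_rpow (by positivity), Real.log_div hL.ne' hD.ne']
    push_cast; ring
  rw [Real.log_mul (by positivity) (by positivity), Real.log_mul (by positivity) (by positivity),
    Real.log_mul (by positivity) (by positivity)]
  rw [optDim, Real.log_mul (by positivity) (by positivity), Real.log_rpow (by norm_num),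
    Real.log_rpow (by positivity), Real.log_div (by positivity) (by positivity),
    Real.log_div (by positivity) (by positivity), Real.log_mul (by positivity) (by positivity),
    Real.log_mul (by positivity) (by positivity), hl]
  field_simp
  ring

/-- Here `2L/d₀ = D d₀` balances the two exponents. The power `L^(1/4)` comes from the factor `√d`
lost by `N₀`, which increases the singleton density `1/N₀`. -/
theorem hasFreeDensity_two {k D : ℕ} (hk : 2 * D < k) (hD : 0 < D) :
    HasFreeDensity k D (densityProfile 2 D) := by
  have hD' : (0 : ℝ) < D := by exact_mod_cast hD
  refine (hasFreeDensity_singleton k (2 * D)).densityProfile le_rfl hk hD fun c₁ hc₁ hc₁1 =>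
    ⟨(√2 * (1 / D) ^ ((1 : ℝ) / 2)) ^ ((1 : ℝ) / 2), by positivity,
      fun L L₀ d hL hd hd₀ hL₀ _ => ?_⟩
  have hd' : (0 : ℝ) < d := by exact_mod_cast hd
  have h0 : 0 < optDim 2 D L := by unfold optDim; positivity
  have h1 := optDim_step (n := 1) le_rfl hD' hL
  have h2 : optDim 1 (2 * D) (2 * L / optDim 2 D L) = 2 * L / optDim 2 D L / (2 * D) := by
    rw [optDim]; norm_num
  norm_num at h1
  rw [h2] at h1
  have h3 : 2 * L / optDim 2 D L = D * optDim 2 D L := by rw [← h1]; field_simp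
  have h4 : 2 * L / d ≤ D * optDim 2 D L := by rw [← h3]; gcongr
  have h5 : (2 : ℝ) ^ (-L₀) = 2 ^ (-(2 * L / d)) * (d : ℝ) ^ ((1 : ℝ) / 2) * c₁⁻¹ := by
    rw [hL₀, show -(2 * L / d - Real.logb 2 d / 2 + Real.logb 2 c₁) =
      -(2 * L / d) + Real.logb 2 d * (1 / 2) + -Real.logb 2 c₁ by ring,
      Real.rpow_add (by norm_num), Real.rpow_add (by norm_num), Real.rpow_mul (by norm_num),
      Real.rpow_neg (by norm_num) (Real.logb 2 c₁), Real.rpow_logb (by norm_num) (by norm_num) hd',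
      Real.rpow_logb (by norm_num) (by norm_num) hc₁]
  have h6 : (√2 * (1 / D) ^ ((1 : ℝ) / 2)) ^ ((1 : ℝ) / 2) * L ^ (1 / (2 * ((2 : ℕ) : ℝ))) =
      optDim 2 D L ^ ((1 : ℝ) / 2) := by
    have : optDim 2 D L = √2 * (1 / D) ^ ((1 : ℝ) / 2) * L ^ ((1 : ℝ) / 2) := by
      rw [optDim, Real.sqrt_eq_rpow, mul_assoc, ← Real.mul_rpow (by positivity) hL.le]
      norm_num
      congr 1; ring
    rw [this, Real.mul_rpow (x := √2 * _) (by positivity) (by positivity), ← Real.rpow_mul hL.le]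
    norm_num
  rw [← mul_assoc, h6]
  simp only [h5]
  calc optDim 2 D L ^ ((1 : ℝ) / 2) * 2 ^ (-(((2 : ℕ) - 1 : ℝ) * D * optDim 2 D L))
      ≤ (d : ℝ) ^ ((1 : ℝ) / 2) * 2 ^ (-(2 * L / d)) * 1 := by
        rw [mul_one]
        gcongr
        · norm_num
        · push_cast; linarith
    _ ≤ (d : ℝ) ^ ((1 : ℝ) / 2) * 2 ^ (-(2 * L / d)) * c₁⁻¹ := by
        gcongr
        exact (one_le_inv₀ hc₁).mpr hc₁1
    _ = _ := by ring

theorem hasFreeDensity_densityProfile {n : ℕ} (hn : 2 ≤ n) : ∀ {k D : ℕ}, 0 < D →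
    2 ^ (n - 1) * D < k → HasFreeDensity k D (densityProfile n D) := by
  induction n, hn using Nat.le_induction with
  | base => exact fun hD hk => hasFreeDensity_two (by simpa using hk) hD
  | succ n hn ih =>
    intro k D hD hk
    have hD' : (0 : ℝ) < D := by exact_mod_cast hD
    have hn' : (0 : ℝ) < n := by exact_mod_cast (by lia : 0 < n)
    have hpow : 2 ^ (n + 1 - 1) * D = 2 ^ (n - 1) * (2 * D) := by
      rw [← mul_assoc, ← pow_succ]; congr 2; lia
    rw [hpow] at hk
    have h2 : 2 * D ≤ 2 ^ (n - 1) * (2 * D) := Nat.le_mul_of_pos_left _ (by positivity)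
    refine (ih (by lia) hk).densityProfile (by lia) (by lia) hD fun c₁ hc₁ hc₁1 => ?_
    set β : ℝ := 2 ^ (((n + 1 : ℕ) : ℝ) / 2 - 1 / 2) * (1 / D) ^ (1 / ((n + 1 : ℕ) : ℝ)) with hβ
    have hβ0 : 0 < β := by positivity
    refine ⟨(1 / (2 * β)) ^ (1 / (2 * (n : ℝ))), by positivity,
      fun L L₀ d hL hd hd₀ hL₀ hL₀ge => ?_⟩
    have hd' : (1 : ℝ) ≤ d := by exact_mod_cast hd
    have h0 : 0 < optDim (n + 1) D L := by unfold optDim; positivity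
    have hopt : optDim (n + 1) D L = β * L ^ (1 / ((n + 1 : ℕ) : ℝ)) := by
      rw [optDim, hβ, mul_assoc, ← Real.mul_rpow (by positivity) hL.le]
      congr 2
      · ring
      · ring
    have hpos : 0 < L / (2 * optDim (n + 1) D L) := by positivity
    have hL₀0 : 0 < L₀ := hpos.trans_le hL₀ge
    have hL₀le : L₀ ≤ 2 * L / optDim (n + 1) D L := by
      have h3 : 2 * L / d ≤ 2 * L / optDim (n + 1) D L := by gcongr
      have h4 : 0 ≤ Real.logb 2 d := Real.logb_nonneg (by norm_num) hd'
      have h5 : Real.logb 2 c₁ ≤ 0 := Real.logb_nonpos (by norm_num) hc₁.le hc₁1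
      linarith
    have h3 := optDim_step (n := n) (by lia) hD' hL
    have h4 : optDim n (2 * D) L₀ ≤ optDim n (2 * D) (2 * L / optDim (n + 1) D L) := by
      unfold optDim at *
      gcongr
    have h5 : n * (2 * D) * optDim n (2 * D) L₀ ≤ n * D * optDim (n + 1) D L := by
      calc _ ≤ n * (2 * D) * optDim n (2 * D) (2 * L / optDim (n + 1) D L) := by gcongr
        _ = n * (2 * D * optDim n (2 * D) (2 * L / optDim (n + 1) D L)) := by ring
        _ = _ := by rw [h3]; ring
    -- The power of `L` is inherited: `L / (2 d₀)` is of order `L^(n/(n+1))`, whose `1/(2n)`-th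
    -- power is `L^(1/(2(n+1)))`.
    have h6 : (1 / (2 * β)) ^ (1 / (2 * (n : ℝ))) * L ^ (1 / (2 * ((n + 1 : ℕ) : ℝ))) =
        (L / (2 * optDim (n + 1) D L)) ^ (1 / (2 * (n : ℝ))) := by
      have h7 : L / (2 * optDim (n + 1) D L) =
          1 / (2 * β) * L ^ ((n : ℝ) / ((n + 1 : ℕ) : ℝ)) := by
        have h8 : L = L ^ ((n : ℝ) / ((n + 1 : ℕ) : ℝ)) * L ^ (1 / ((n + 1 : ℕ) : ℝ)) := by
          rw [← Real.rpow_add hL]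
          conv_lhs => rw [← Real.rpow_one L]
          congr 1; push_cast; field_simp
        rw [hopt]
        have h9 : L ^ (1 / ((n + 1 : ℕ) : ℝ)) ≠ 0 := by positivity
        rw [div_eq_iff (by positivity)]
        conv_lhs => rw [h8]
        generalize L ^ (1 / ((n + 1 : ℕ) : ℝ)) = z at *
        field_simp
      rw [h7, Real.mul_rpow (by positivity) (by positivity), ← Real.rpow_mul hL.le]
      congr 2
      push_cast; field_simp
    rw [← mul_assoc, h6, _root_.densityProfile]
    have h7 : -(((n + 1 : ℕ) - 1) * D * optDim (n + 1) D L) ≤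
        -(n * ((2 * D : ℕ) : ℝ) * optDim n (2 * D : ℕ) L₀) := by
      push_cast; linarith
    gcongr
    norm_num

/-! ### The bound for general `k` -/

theorem exists_le_rMax_div {k n : ℕ} (hk : 3 ≤ k) (hn : n = ⌈Real.logb 2 (k : ℝ)⌉₊) :
    ∃ C : ℝ, 0 < C ∧ ∀ N : ℝ, 1 ≤ N →
      (rMax k ⌊N⌋₊ : ℝ) / N ≥
        C * ((Real.logb 2 N) ^ ((1 : ℝ) / (2 * (n : ℝ))) /
          (2 : ℝ) ^ ((n : ℝ) * (2 : ℝ) ^ (((n : ℝ) - 1) / 2) *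
            (Real.logb 2 N) ^ ((1 : ℝ) / (n : ℝ)))) := by
  have hk' : (3 : ℝ) ≤ k := by exact_mod_cast hk
  -- The ceiling makes `n` the largest integer with `2^(n-1) < k`, that is, the deepest recursion
  -- allowed.
  have hlt : ∀ m : ℕ, m < n ↔ 2 ^ m < k := fun m => by
    rw [hn, Nat.lt_ceil, Real.lt_logb_iff_rpow_lt (by norm_num) (by linarith), Real.rpow_natCast]
    exact_mod_cast Iff.rfl
  have hn2 : 2 ≤ n := (hlt 1).mpr (by lia)
  have hpow : 2 ^ (n - 1) * 1 < k := by rw [mul_one]; exact (hlt _).mp (by lia)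
  obtain ⟨C, hC, h⟩ := hasFreeDensity_densityProfile hn2 one_pos hpow
  refine ⟨C, hC, fun N hN => ?_⟩
  obtain ⟨A, hA, hfree, hcard⟩ := h N hN
  have h1 : (A.card : ℝ) ≤ rMax k ⌊N⌋₊ := by exact_mod_cast hfree.card_le_rMax hk hA
  rw [ge_iff_le, le_div_iff₀ (by linarith)]
  refine le_trans (le_of_eq ?_) (hcard.trans h1)
  rw [densityProfile, optDim, Real.rpow_neg (by norm_num)]
  norm_num
  rw [div_eq_mul_inv, ← mul_assoc (n : ℝ)]
  ring

/-! ### The explicit constant for `k = 3` -/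

/-- A lower bound for the normalized density of the sets coming from `d`-dimensional shells centred
in the window of half-width `η √d` around the mean. -/
noncomputable def shellDensity (η : ℝ) (d : ℕ) : ℝ :=
  2 ^ (-(1 / (d : ℝ))) * √(d / (d + 1)) * 4 ^ (-2 / (d : ℝ)) * (8 / (Real.pi * Real.exp 1)) *
    ((sqSumLaw d).real (Set.Icc (d / 3 - η * √d) (d / 3 + η * √d)) /
      (2 * η + 16 * (√d * 2 ^ (-(d : ℝ)))))

lemma tendsto_const_rpow_div_natCast {x : ℝ} (hx : 0 < x) (y : ℝ) :
    Tendsto (fun d : ℕ => x ^ (y / (d : ℝ))) atTop (𝓝 1) := by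
  have h := ((Real.continuous_const_rpow hx.ne').tendsto 0).comp
    (tendsto_const_div_atTop_nhds_zero_nat y)
  rwa [Real.rpow_zero] at h

lemma tendsto_shellDensity {η : ℝ} (hη : 0 < η) :
    Tendsto (shellDensity η) atTop (𝓝 (8 / (Real.pi * Real.exp 1) *
      ((gaussianReal 0 (4 / 45)).real (Set.Icc (-η) η) / (2 * η)))) := by
  have h1 : Tendsto (fun d : ℕ => (2 : ℝ) ^ (-(1 / (d : ℝ)))) atTop (𝓝 1) := by
    simpa only [neg_div] using tendsto_const_rpow_div_natCast two_pos (-1)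
  have h2 : Tendsto (fun d : ℕ => √((d : ℝ) / (d + 1))) atTop (𝓝 1) := by
    have := (Real.continuous_sqrt.tendsto 1).comp (tendsto_natCast_div_add_atTop (1 : ℝ))
    rwa [Real.sqrt_one] at this
  have h3 := tendsto_const_rpow_div_natCast (x := 4) (by norm_num) (-2)
  have h4 : Tendsto (fun d : ℕ => √(d : ℝ) * 2 ^ (-(d : ℝ))) atTop (𝓝 0) := by
    refine squeeze_zero (fun d => by positivity) (fun d => ?_)
      (tendsto_self_mul_const_pow_of_lt_one (r := 1 / 2) (by norm_num) (by norm_num))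
    rw [Real.rpow_neg two_pos.le, Real.rpow_natCast, one_div, inv_pow]
    gcongr
    rcases d.eq_zero_or_pos with rfl | hd
    · simp
    · have : (1 : ℝ) ≤ d := by exact_mod_cast hd
      rw [Real.sqrt_le_left (by positivity)]
      nlinarith
  have h5 : Tendsto (fun d : ℕ => 2 * η + 16 * (√(d : ℝ) * 2 ^ (-(d : ℝ)))) atTop (𝓝 (2 * η)) := by
    simpa using (h4.const_mul 16).const_add (2 * η)
  have h6 := (((h1.mul h2).mul h3).mul_const (8 / (Real.pi * Real.exp 1))).mul
    ((tendsto_sqSumLaw_Icc (η := η)).div h5 (by positivity))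
  rw [one_mul, one_mul, one_mul] at h6
  exact h6

/-- The dimension is `s = √(2 log N)` rounded down. The corrections `2^(-1/d)` and `√(d/(d+1))` pay
for the rounding, `4^(-2/d)` comes from the factor `2^(D+1)` in the shell width, and all tend to
`1`. -/
lemma floor_mul_shellDensity_le {η N s : ℝ} (hη : 0 < η) (hN : 1 ≤ N)
    (hs : s = √(2 * Real.logb 2 N)) (hs1 : 1 ≤ s) :
    ⌊N⌋₊ * (shellDensity η ⌊s⌋₊ * (√s * 2 ^ (-(2 * s)))) ≤ rMax 3 ⌊N⌋₊ := by
  set d := ⌊s⌋₊ with hd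
  have hN0 : 0 < N := by linarith
  have hd1 : 1 ≤ d := Nat.le_floor (by simpa using hs1)
  have hd0 : (0 : ℝ) < d := by exact_mod_cast hd1
  have hds : (d : ℝ) ≤ s := Nat.floor_le (by linarith)
  have hsd : s < d + 1 := Nat.lt_floor_add_one s
  have hsq : 0 < √(d : ℝ) := Real.sqrt_pos.mpr hd0
  have hsq2 : √(d : ℝ) * √d = d := Real.mul_self_sqrt hd0.le
  have hNs : N = 2 ^ (s ^ 2 / 2) := by
    have h1 : s ^ 2 / 2 = Real.logb 2 N := by
      rw [hs, Real.sq_sqrt (by have := Real.logb_nonneg one_lt_two hN; positivity)]; ring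
    rw [h1, Real.rpow_logb two_pos (by norm_num) hN0]
  obtain ⟨A, hA, hfree, hcard⟩ := exists_isFree_shell (k := 3) le_rfl hd1 hN0
    (a := d / 3 - η * √d) (b := d / 3 + η * √d) (by
      have : 0 < η * √(d : ℝ) := by positivity
      linarith)
  have hr : (A.card : ℝ) ≤ rMax 3 ⌊N⌋₊ := by exact_mod_cast hfree.card_le_rMax le_rfl hA
  refine le_trans ?_ (hcard.trans hr)
  set P := (sqSumLaw d).real (Set.Icc (d / 3 - η * √d) (d / 3 + η * √d)) with hP
  have hP0 : 0 ≤ P := measureReal_nonneg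
  set E : ℝ := 1 / (2 * Real.pi * Real.exp 1) * 4 ^ (-2 / (d : ℝ)) * 2 ^ (-(s ^ 2 / d)) with hE
  have hE0 : 0 < E := by positivity
  have hτ : shellWidth 1 d N = √d * √d * E := by
    have h1 : (2 ^ (1 + 1) * N) ^ (-2 / (d : ℝ)) = 4 ^ (-2 / (d : ℝ)) * 2 ^ (-(s ^ 2 / d)) := by
      rw [Real.mul_rpow (by norm_num) hN0.le]
      congr 1
      · norm_num
      · rw [hNs, ← Real.rpow_mul two_pos.le]
        congr 1; field_simp
    rw [shellWidth, h1, hE, hsq2]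
    push_cast; ring
  have hEle : E ≤ 2 ^ (-(d : ℝ)) := by
    have h1 : 1 / (2 * Real.pi * Real.exp 1) ≤ 1 := by
      rw [div_le_one (by positivity)]
      have := Real.pi_gt_three
      have := Real.exp_one_gt_d9
      nlinarith
    have h2 : (4 : ℝ) ^ (-2 / (d : ℝ)) ≤ 1 :=
      Real.rpow_le_one_of_one_le_of_nonpos (by norm_num)
        (div_nonpos_of_nonpos_of_nonneg (neg_nonpos.mpr zero_le_two) hd0.le)
    have h3 : (2 : ℝ) ^ (-(s ^ 2 / d)) ≤ 2 ^ (-(d : ℝ)) := by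
      refine Real.rpow_le_rpow_of_exponent_le one_le_two (neg_le_neg ?_)
      rw [le_div_iff₀ hd0]; nlinarith
    calc E ≤ 1 * 1 * 2 ^ (-(d : ℝ)) := by rw [hE]; gcongr
      _ = _ := by ring
  have hfrac : 16 * shellWidth 1 d N * P /
      (d / 3 + η * √d - (d / 3 - η * √d) + 16 * shellWidth 1 d N) =
      16 * √d * E * (P / (2 * η + 16 * (√d * E))) := by
    rw [hτ]
    have : d / 3 + η * √(d : ℝ) - (d / 3 - η * √d) + 16 * (√d * √d * E) =
        √d * (2 * η + 16 * (√d * E)) := by ring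
    rw [this]
    field_simp
  rw [hfrac]
  have h1 : √((d : ℝ) / (d + 1)) * √s ≤ √d := by
    rw [← Real.sqrt_mul (by positivity)]
    refine Real.sqrt_le_sqrt ?_
    rw [div_mul_eq_mul_div, div_le_iff₀ (by positivity)]
    gcongr
  have h2 : (2 : ℝ) ^ (-(1 / (d : ℝ))) * 2 ^ (-(2 * s)) ≤ (1 / 2) ^ d * 2 ^ (-(s ^ 2 / d)) := by
    have h3 : ((1 : ℝ) / 2) ^ d = 2 ^ (-(d : ℝ)) := by
      rw [Real.rpow_neg two_pos.le, Real.rpow_natCast, one_div, inv_pow]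
    rw [h3, ← Real.rpow_add two_pos, ← Real.rpow_add two_pos]
    refine Real.rpow_le_rpow_of_exponent_le one_le_two ?_
    -- Since `d + s²/d = 2s + (s - d)²/d`, rounding changes the exponent only to second order, by at
    -- most `1/d`.
    have h4 : -(d : ℝ) + -(s ^ 2 / d) - (-(1 / (d : ℝ)) + -(2 * s)) = (1 - (s - d) ^ 2) / d := by
      field_simp; ring
    have h5 : 0 ≤ (1 - (s - d) ^ 2) / (d : ℝ) := by
      refine div_nonneg ?_ hd0.le
      nlinarith
    linarith
  have h6 : P / (2 * η + 16 * (√d * 2 ^ (-(d : ℝ)))) ≤ P / (2 * η + 16 * (√d * E)) := by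
    gcongr
  refine mul_le_mul_of_nonneg_left ?_ (Nat.cast_nonneg _)
  calc shellDensity η d * (√s * 2 ^ (-(2 * s)))
      = (2 ^ (-(1 / (d : ℝ))) * 2 ^ (-(2 * s))) * (√(d / (d + 1)) * √s) *
        (4 ^ (-2 / (d : ℝ)) * (8 / (Real.pi * Real.exp 1))) *
        (P / (2 * η + 16 * (√d * 2 ^ (-(d : ℝ))))) := by rw [shellDensity]; ring
    _ ≤ ((1 / 2) ^ d * 2 ^ (-(s ^ 2 / d))) * √d *
        (4 ^ (-2 / (d : ℝ)) * (8 / (Real.pi * Real.exp 1))) * (P / (2 * η + 16 * (√d * E))) := by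
        gcongr
    _ = (1 / 2) ^ d * (16 * √d * E * (P / (2 * η + 16 * (√d * E)))) := by
        rw [hE]; field_simp; ring

/-- The target constant is `8/(π e)` times the density at `0` of the centred Gaussian of variance
`4/45`; on `[-η, η]` the density drops by at most the exponential factor. -/
lemma sqrt_360_div_mul_exp_le {η : ℝ} (hη : 0 < η) :
    √360 / (Real.exp 1 * Real.pi ^ ((3 : ℝ) / 2)) * Real.exp (-η ^ 2 / (8 / 45)) ≤
      8 / (Real.pi * Real.exp 1) * ((gaussianReal 0 (4 / 45)).real (Set.Icc (-η) η) / (2 * η)) := by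
  have h := le_gaussianReal_Icc (v := 4 / 45) (by norm_num) η
  have hv : ((4 / 45 : NNReal) : ℝ) = 4 / 45 := by push_cast; rfl
  rw [hv, show 2 * (4 / 45 : ℝ) = 8 / 45 by norm_num, ← le_div_iff₀ (by positivity)] at h
  have hpi : Real.pi ^ ((3 : ℝ) / 2) = Real.pi * √Real.pi := by
    rw [Real.sqrt_eq_rpow, show (3 : ℝ) / 2 = 1 + 1 / 2 by norm_num, Real.rpow_add Real.pi_pos,
      Real.rpow_one]
  have h360 : √360 * √(2 * Real.pi * (4 / 45)) = 8 * √Real.pi := by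
    rw [← Real.sqrt_mul (by norm_num), show 360 * (2 * Real.pi * (4 / 45)) = 8 ^ 2 * Real.pi by ring,
      Real.sqrt_mul (by norm_num), Real.sqrt_sq (by norm_num)]
  calc √360 / (Real.exp 1 * Real.pi ^ ((3 : ℝ) / 2)) * Real.exp (-η ^ 2 / (8 / 45))
      = 8 / (Real.pi * Real.exp 1) *
        ((√(2 * Real.pi * (4 / 45)))⁻¹ * Real.exp (-η ^ 2 / (8 / 45))) := by
        have h1 : √360 = 8 * √Real.pi / √(2 * Real.pi * (4 / 45)) := by
          rw [← h360]; field_simp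
        rw [hpi, h1]
        field_simp
    _ ≤ _ := by gcongr

theorem exists_forall_le_rMax_three {ε : ℝ} (hε : 0 < ε) : ∃ N₀ : ℝ, ∀ N : ℝ, N₀ ≤ N →
    (rMax 3 ⌊N⌋₊ : ℝ) / N ≥
      (Real.sqrt 360 / (Real.exp 1 * Real.pi ^ ((3 : ℝ) / 2)) - ε) *
        ((2 * Real.logb 2 N) ^ ((1 : ℝ) / 4) /
          (2 : ℝ) ^ (2 * Real.sqrt (2 * Real.logb 2 N))) := by
  set κ := √360 / (Real.exp 1 * Real.pi ^ ((3 : ℝ) / 2)) with hκ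
  obtain ⟨η, hη, hηκ⟩ : ∃ η : ℝ, 0 < η ∧ κ - ε < κ * Real.exp (-η ^ 2 / (8 / 45)) := by
    have h1 : Tendsto (fun η : ℝ => κ * Real.exp (-η ^ 2 / (8 / 45))) (𝓝[>] 0) (𝓝 κ) := by
      have : Continuous fun η : ℝ => κ * Real.exp (-η ^ 2 / (8 / 45)) := by fun_prop
      simpa using (this.tendsto 0).mono_left nhdsWithin_le_nhds
    obtain ⟨η, h2, h3⟩ := ((h1.eventually (lt_mem_nhds (sub_lt_self κ hε))).and
      self_mem_nhdsWithin).exists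
    exact ⟨η, h3, h2⟩
  have hs : Tendsto (fun N : ℝ => √(2 * Real.logb 2 N)) atTop atTop :=
    Real.tendsto_sqrt_atTop.comp ((Real.tendsto_logb_atTop one_lt_two).const_mul_atTop two_pos)
  have h1 := (tendsto_nat_floor_div_atTop (R := ℝ)).mul
    ((tendsto_shellDensity hη).comp (tendsto_nat_floor_atTop.comp hs))
  rw [one_mul] at h1
  have h2 := (h1.eventually (lt_mem_nhds (hηκ.trans_le (sqrt_360_div_mul_exp_le hη)))).and
    ((hs.eventually_ge_atTop 1).and (eventually_ge_atTop 1))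
  obtain ⟨N₀, hN₀⟩ := eventually_atTop.mp h2
  refine ⟨N₀, fun N hN => ?_⟩
  obtain ⟨h3, hs1, hN1⟩ := hN₀ N hN
  have hN0 : 0 < N := by linarith
  have hL := Real.logb_nonneg one_lt_two hN1
  have h4 := floor_mul_shellDensity_le hη hN1 rfl hs1
  have h5 : (2 * Real.logb 2 N) ^ ((1 : ℝ) / 4) = √√(2 * Real.logb 2 N) := by
    rw [Real.sqrt_eq_rpow, Real.sqrt_eq_rpow, ← Real.rpow_mul (by positivity)]
    norm_num
  rw [h5, div_eq_mul_inv _ ((2 : ℝ) ^ _), ← Real.rpow_neg two_pos.le, ge_iff_le, le_div_iff₀ hN0]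
  simp only [Function.comp_apply] at h3
  set s := √(2 * Real.logb 2 N)
  calc (κ - ε) * (√s * 2 ^ (-(2 * s))) * N
      ≤ ⌊N⌋₊ / N * shellDensity η ⌊s⌋₊ * (√s * 2 ^ (-(2 * s))) * N := by gcongr
    _ = ⌊N⌋₊ * (shellDensity η ⌊s⌋₊ * (√s * 2 ^ (-(2 * s)))) := by field_simp
    _ ≤ _ := h4

theorem corollary1 :
    (∀ k n : ℕ, 3 ≤ k → n = ⌈Real.logb 2 (k : ℝ)⌉₊ →
      ∃ C : ℝ, 0 < C ∧ ∀ N : ℝ, 1 ≤ N →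
        (rMax k ⌊N⌋₊ : ℝ) / N ≥
          C * ((Real.logb 2 N) ^ ((1 : ℝ) / (2 * (n : ℝ))) /
            (2 : ℝ) ^ ((n : ℝ) * (2 : ℝ) ^ (((n : ℝ) - 1) / 2) *
              (Real.logb 2 N) ^ ((1 : ℝ) / (n : ℝ))))) ∧
    (∀ ε : ℝ, 0 < ε → ∃ N₀ : ℝ, ∀ N : ℝ, N₀ ≤ N →
      (rMax 3 ⌊N⌋₊ : ℝ) / N ≥
        (Real.sqrt 360 / (Real.exp 1 * Real.pi ^ ((3 : ℝ) / 2)) - ε) *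
          ((2 * Real.logb 2 N) ^ ((1 : ℝ) / 4) /
            (2 : ℝ) ^ (2 * Real.sqrt (2 * Real.logb 2 N)))) :=
  ⟨fun _ _ => exists_le_rMax_div, fun _ => exists_forall_le_rMax_three⟩
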